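/- For integers $q\ge 1$, $a$ and $n\ge 1$ let $\Omega(n;q,a)$ be the number of prime factors $p\equiv a \pmod q$ of $n$, counted with multiplicity, and let $\lambda(n;q,a)=(-1)^{\Omega(n;q,a)}$. Let $\chi_4$ be the non-principal Dirichlet character modulo $4$, and let $L(s,\chi_4)$ denote its (analytically continued) $L$-function. Then the following hold. 1. For every complex $s$ with $\operatorname{Re}(s)>1$ we have $L(s,\chi_4)\neq 0$, and the series $D(s;4,1)=\sum_{n\ge 1}\lambda(n;4,1)n^{-s}$ converges absolutely and satisfies $$D(s;4,1)=\frac{\zeta(2s)\,(1+2^{-s})}{L(s,\chi_4)}.$$ 2. Unconditionally, $\sum_{1\le n\leq x}\lambda(n;4,1)=o(x)$ as $x\to\infty$. 3. If the Riemann hypothesis holds for $L(s,\chi_4)$ (that is, every zero of $L(s,\chi_4)$ with $0<\operatorname{Re}(s)<1$ has $\operatorname{Re}(s)=\tfrac12$), then for every $\epsilon>0$, $\sum_{1\le n\leq x}\lambda(n;4,1)=O_\epsilon(x^{1/2+\epsilon})$ as $x\to\infty$. 4. For every real $x\ge 1$, $\sum_{1\le n\leq x}\lambda(n;4,3)\ge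 0$; and for every $\epsilon>0$, $\sum_{1\le n\leq x}\lambda(n;4,3)=o(x^{\epsilon})$ as $x\to\infty$. -/

import Mathlib

open Filter Asymptotics

/-- `Ω(n;q,a)`: the number of prime factors of `n`, counted with multiplicity, that are congruent
to `a` modulo `q`. -/
def OmegaAP (q a n : ℕ) : ℕ :=
  n.primeFactorsList.countP (fun p => p ≡ a [MOD q])

/-- The Liouville function for an arithmetic progression, `λ(n;q,a) = (-1)^Ω(n;q,a)`. -/
def liouvilleAP (q a n : ℕ) : ℤ :=
  (-1) ^ OmegaAP q a n

/-- The summatory function `L(x;q,a) = ∑_{n ≤ x} λ(n;q,a)`, over integers `1 ≤ n ≤ x`. -/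
noncomputable def liouvilleAPSum (q a : ℕ) (x : ℝ) : ℝ :=
  ∑ n ∈ Finset.Icc 1 ⌊x⌋₊, (liouvilleAP q a n : ℝ)

/-- The non-principal Dirichlet character modulo `4`, with complex values. -/
def chiFour : DirichletCharacter ℂ 4 :=
  ZMod.χ₄.ringHomComp (Int.castRingHom ℂ)

/-- The Riemann hypothesis for `L(s,χ)`, where `L(s,χ)` is the analytically continued L-function:
every zero in the critical strip `0 < Re s < 1` lies on the line `Re s = 1/2`. -/
def LFunctionRiemannHypothesis {N : ℕ} [NeZero N] (χ : DirichletCharacter ℂ N) : Prop :=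
  ∀ s : ℂ, 0 < s.re → s.re < 1 → DirichletCharacter.LFunction χ s = 0 → s.re = 1 / 2

/-! At an odd prime `λ(p;4,1) = -χ₄(p)`, and `λ(2;4,1) = 1`. Multiplying the Euler products of
`D(s;4,1)` and `L(s,χ₄)` therefore gives `(1 - p^{-2s})⁻¹` at each odd `p`, while the factor at 2 is
`(1 - 2^{-s})⁻¹ = (1 + 2^{-s})(1 - 2^{-2s})⁻¹`. This is `LSeries_liouvilleAP_mul_LFunction`, from
which the formula for `D` follows.

Unconditionally, `L(s,χ₄)` has no zero on `Re s ≥ 1`, so `D` extends continuously to that closed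
half-plane. The function `e^{-u} ∑_{n ≤ e^u} λ(n;4,1)` is bounded and slowly varying, with Laplace
transform `D(1+s)/(1+s)`; the Tauberian theorem `tendsto_zero_of_laplace_continuousOn` sends it to
zero.

Under the Riemann hypothesis, `log L(s,χ₄)` exists on `Re s > 1/2`. Borel-Carathéodory makes it
`O(log |t|)` and the three lines theorem improves this to `ε log |t| + O(1)` (`exists_norm_log_le`),
so `1/L` grows more slowly than any power of `|t|`. Perron's formula, shifted to `Re s = 1/2 + ε/2`,
then bounds the sum.

For the class 3, `λ(n;4,3)` equals `χ₄(n)` at odd `n` and is unchanged under `n ↦ 2n`. Its sum up to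
`N` is thus the sum of `χ₄`, which is 0 or 1, plus its own sum up to `N/2`; it is nonnegative and
`O(log N)`. -/

/-! ### Complete multiplicativity of `λ(n;q,a)`. -/

lemma OmegaAP_mul (q a : ℕ) {m n : ℕ} (hm : m ≠ 0) (hn : n ≠ 0) :
    OmegaAP q a (m * n) = OmegaAP q a m + OmegaAP q a n := by
  unfold OmegaAP
  rw [(Nat.perm_primeFactorsList_mul hm hn).countP_eq, List.countP_append]

lemma liouvilleAP_mul (q a : ℕ) {m n : ℕ} (hm : m ≠ 0) (hn : n ≠ 0) :
    liouvilleAP q a (m * n) = liouvilleAP q a m * liouvilleAP q a n := by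
  rw [liouvilleAP, OmegaAP_mul q a hm hn, pow_add]
  rfl

lemma liouvilleAP_one (q a : ℕ) : liouvilleAP q a 1 = 1 := by
  simp [liouvilleAP, OmegaAP]

lemma liouvilleAP_prime (q a : ℕ) {p : ℕ} (hp : p.Prime) :
    liouvilleAP q a p = if p ≡ a [MOD q] then -1 else 1 := by
  rw [liouvilleAP, OmegaAP, Nat.primeFactorsList_prime hp]
  split_ifs with h <;> simp [h]

lemma abs_liouvilleAP (q a n : ℕ) : |(liouvilleAP q a n : ℝ)| = 1 := by
  simp [liouvilleAP]

lemma norm_liouvilleAP (q a n : ℕ) : ‖(liouvilleAP q a n : ℂ)‖ = 1 := by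
  simp [liouvilleAP]

/-- `n ↦ λ(n;q,a)` as a completely multiplicative function, sending `0` to `0`. -/
noncomputable def liouvilleAPHom (q a : ℕ) : ℕ →*₀ ℂ where
  toFun n := if n = 0 then 0 else (liouvilleAP q a n : ℂ)
  map_zero' := by simp
  map_one' := by simp [liouvilleAP_one]
  map_mul' m n := by
    by_cases hm : m = 0
    · simp [hm]
    by_cases hn : n = 0
    · simp [hn]
    simp [hm, hn, liouvilleAP_mul q a hm hn]

/-! ### Partial sums of `χ₄` and of `λ(n;4,3)` -/

lemma sum_chi_four (n : ℕ) :
    ∑ k ∈ Finset.Icc 1 n, ZMod.χ₄ (k : ZMod 4) = if n % 4 = 1 ∨ n % 4 = 2 then 1 else 0 := by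
  induction n with
  | zero => simp
  | succ n ih =>
    rw [Finset.sum_Icc_succ_top (by omega), ih, ZMod.χ₄_nat_eq_if_mod_four]
    split_ifs <;> omega

lemma liouvilleAP_four_three_two : liouvilleAP 4 3 2 = 1 := by
  rw [liouvilleAP_prime 4 3 Nat.prime_two, if_neg (by decide)]

lemma liouvilleAP_four_three_of_odd {n : ℕ} (hn : n % 2 = 1) :
    liouvilleAP 4 3 n = ZMod.χ₄ (n : ZMod 4) := by
  induction n using Nat.recOnMul with
  | zero => simp at hn
  | one => simp [liouvilleAP_one]
  | prime p hp =>
    rw [liouvilleAP_prime 4 3 hp, ZMod.χ₄_nat_eq_if_mod_four]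
    simp only [Nat.ModEq]
    split_ifs <;> omega
  | mul a b iha ihb =>
    have h := Nat.odd_mul.mp (Nat.odd_iff.mpr hn)
    have ha := Nat.odd_iff.mp h.1
    have hb := Nat.odd_iff.mp h.2
    rw [liouvilleAP_mul 4 3 (by omega) (by omega), iha ha, ihb hb]
    push_cast
    rw [map_mul]

/-- In the difference of the two sums the odd terms cancel, and `n = 2k` contributes `λ(k;4,3)`
because `χ₄(2k) = 0`. -/
lemma sum_liouvilleAP_four_three (N : ℕ) :
    ∑ n ∈ Finset.Icc 1 N, liouvilleAP 4 3 n =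
      ∑ n ∈ Finset.Icc 1 N, ZMod.χ₄ (n : ZMod 4) +
        ∑ n ∈ Finset.Icc 1 (N / 2), liouvilleAP 4 3 n := by
  have key : ∀ N : ℕ, ∑ n ∈ Finset.Icc 1 N,
      (liouvilleAP 4 3 n - ZMod.χ₄ (n : ZMod 4)) =
        ∑ n ∈ Finset.Icc 1 (N / 2), liouvilleAP 4 3 n := by
    intro N
    induction N with
    | zero => simp
    | succ N ih =>
      rw [Finset.sum_Icc_succ_top (by omega), ih]
      rcases Nat.even_or_odd' (N + 1) with ⟨k, hk | hk⟩
      · rw [show (N + 1) / 2 = N / 2 + 1 by omega, Finset.sum_Icc_succ_top (by omega),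
          show N / 2 + 1 = k by omega, hk,
          liouvilleAP_mul 4 3 two_ne_zero (by omega), liouvilleAP_four_three_two,
          ZMod.χ₄_nat_eq_if_mod_four, if_pos (by omega)]
        ring
      · rw [liouvilleAP_four_three_of_odd (by omega), sub_self, add_zero,
          show (N + 1) / 2 = N / 2 by omega]
  rw [← key N, Finset.sum_sub_distrib]
  ring

/-- Each halving of `N` adds 0 or 1 to the sum and lowers `Nat.log 2 N` by one. -/
lemma sum_liouvilleAP_four_three_bounds (N : ℕ) :
    0 ≤ ∑ n ∈ Finset.Icc 1 N, liouvilleAP 4 3 n ∧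
      ∑ n ∈ Finset.Icc 1 N, liouvilleAP 4 3 n ≤ Nat.log 2 N + 1 := by
  induction N using Nat.strong_induction_on with
  | _ N ih =>
    rcases Nat.lt_or_ge N 2 with h | h
    · interval_cases N <;> simp [liouvilleAP_one]
    · rw [sum_liouvilleAP_four_three, sum_chi_four, Nat.log_of_one_lt_of_le one_lt_two h]
      have := ih (N / 2) (by omega)
      push_cast
      split_ifs <;> constructor <;> omega

lemma liouvilleAPSum_four_three_nonneg (x : ℝ) : 0 ≤ liouvilleAPSum 4 3 x := by
  unfold liouvilleAPSum
  exact_mod_cast (sum_liouvilleAP_four_three_bounds ⌊x⌋₊).1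

lemma liouvilleAPSum_four_three_isLittleO {ε : ℝ} (hε : 0 < ε) :
    (fun x : ℝ => liouvilleAPSum 4 3 x) =o[atTop] (fun x : ℝ => x ^ ε) := by
  have h1 : (fun x : ℝ => liouvilleAPSum 4 3 x) =O[atTop] Real.log := by
    refine IsBigO.of_bound (1 / Real.log 2 + 1) ?_
    filter_upwards [eventually_ge_atTop (Real.exp 1)] with x hx
    have hx1 : 1 ≤ x := le_trans (by simp) hx
    have hlog : 1 ≤ Real.log x := by
      rwa [Real.le_log_iff_exp_le (by linarith)]
    rw [Real.norm_of_nonneg (liouvilleAPSum_four_three_nonneg x),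
      Real.norm_of_nonneg (by linarith)]
    have h2 : liouvilleAPSum 4 3 x ≤ Nat.log 2 ⌊x⌋₊ + 1 := by
      unfold liouvilleAPSum
      exact_mod_cast (sum_liouvilleAP_four_three_bounds ⌊x⌋₊).2
    have h3 : (Nat.log 2 ⌊x⌋₊ : ℝ) ≤ Real.log x / Real.log 2 := by
      rw [le_div_iff₀ (Real.log_pos one_lt_two), ← Real.log_pow]
      apply Real.log_le_log (by positivity)
      calc (2 : ℝ) ^ Nat.log 2 ⌊x⌋₊ ≤ (⌊x⌋₊ : ℝ) := by
            exact_mod_cast Nat.pow_log_le_self 2 (Nat.floor_pos.mpr hx1).ne'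
        _ ≤ x := Nat.floor_le (by linarith)
    calc _ ≤ _ := h2
      _ ≤ Real.log x / Real.log 2 + Real.log x := by linarith
      _ = _ := by ring
  exact h1.trans_isLittleO (isLittleO_log_rpow_atTop hε)

/-! ### The Dirichlet series of `λ(n;4,1)` -/

lemma chiFour_natCast (n : ℕ) : chiFour (n : ZMod 4) = ((ZMod.χ₄ (n : ZMod 4) : ℤ) : ℂ) := rfl

lemma chiFour_ne_one : chiFour ≠ 1 := by
  intro h
  have h3 := chiFour_natCast 3
  rw [h, ZMod.χ₄_nat_eq_if_mod_four, MulChar.one_apply (by decide)] at h3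
  norm_num at h3

lemma LFunction_chiFour_ne_zero_of_one_le_re {s : ℂ} (hs : 1 ≤ s.re) :
    DirichletCharacter.LFunction chiFour s ≠ 0 :=
  DirichletCharacter.LFunction_ne_zero_of_one_le_re chiFour (Or.inl chiFour_ne_one) hs

lemma LSeriesSummable_liouvilleAP (q a : ℕ) {s : ℂ} (hs : 1 < s.re) :
    LSeriesSummable (fun n => (liouvilleAP q a n : ℂ)) s :=
  LSeriesSummable_of_bounded_of_one_lt_re (m := 1) (fun n _ => (norm_liouvilleAP q a n).le) hs

open EulerProduct in
lemma LSeries_liouvilleAP_eulerProduct (q a : ℕ) {s : ℂ} (hs : 1 < s.re) :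
    HasProd (fun p : Nat.Primes => (1 - (liouvilleAP q a p : ℂ) * (p : ℂ) ^ (-s))⁻¹)
      (LSeries (fun n => (liouvilleAP q a n : ℂ)) s) := by
  have hs0 : s ≠ 0 := Complex.ne_zero_of_one_lt_re hs
  let f : ℕ →*₀ ℂ :=
    { toFun := fun n => liouvilleAPHom q a n * riemannZetaSummandHom hs0 n
      map_zero' := by simp
      map_one' := by simp
      map_mul' := fun m n => by simp only [map_mul]; ring }
  have hf : ∀ n, f n = LSeries.term (fun n => (liouvilleAP q a n : ℂ)) s n := by
    intro n
    rcases eq_or_ne n 0 with rfl | hn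
    · simp [f]
    · simp [f, hn, liouvilleAPHom, riemannZetaSummandHom, LSeries.term_of_ne_zero,
        Complex.cpow_neg, div_eq_mul_inv]
  have hsum : Summable (‖f ·‖) := by
    simp_rw [hf]
    exact (LSeriesSummable_liouvilleAP q a hs).norm
  have h := eulerProduct_completely_multiplicative_hasProd hsum
  rw [tsum_congr hf] at h
  convert! h using 3 with p
  simp [f, liouvilleAPHom, riemannZetaSummandHom, p.prop.ne_zero]

lemma prime_cpow_neg_ne_one {p : ℕ} (hp : p.Prime) {s : ℂ} (hs : 0 < s.re) :
    1 - (p : ℂ) ^ (-s) ≠ 0 ∧ 1 + (p : ℂ) ^ (-s) ≠ 0 := by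
  have h : ‖(p : ℂ) ^ (-s)‖ < 1 := by
    rw [Complex.norm_natCast_cpow_of_pos hp.pos, Complex.neg_re]
    exact Real.rpow_lt_one_of_one_lt_of_neg (mod_cast hp.one_lt) (by linarith)
  constructor <;> intro h0
  · rw [← sub_eq_zero.mp h0] at h; simp at h
  · rw [eq_neg_of_add_eq_zero_right h0] at h; simp at h

lemma LSeries_liouvilleAP_mul_LFunction {s : ℂ} (hs : 1 < s.re) :
    LSeries (fun n => (liouvilleAP 4 1 n : ℂ)) s * DirichletCharacter.LFunction chiFour s =
      riemannZeta (2 * s) * (1 + (2 : ℂ) ^ (-s)) := by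
  have h1 := LSeries_liouvilleAP_eulerProduct 4 1 hs
  have h2 := DirichletCharacter.LSeries_eulerProduct_hasProd chiFour hs
  have h3 := riemannZeta_eulerProduct_hasProd (s := 2 * s) (by simp; linarith)
  -- The factor `1 + 2^{-s}` is written as a product over primes that is trivial away from 2, so
  -- that the identity can be checked prime by prime.
  have h4 := hasProd_ite_eq (⟨2, Nat.prime_two⟩ : Nat.Primes) (1 + (2 : ℂ) ^ (-s))
  rw [DirichletCharacter.LFunction_eq_LSeries chiFour hs]
  refine (h1.mul h2).unique ?_
  convert h3.mul h4 using 2 with p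
  obtain ⟨p, hp⟩ := p
  have hsq : (p : ℂ) ^ (-(2 * s)) = ((p : ℂ) ^ (-s)) ^ 2 := by
    rw [← Complex.cpow_nat_mul]; congr 1; push_cast; ring
  obtain ⟨hm, hpl⟩ := prime_cpow_neg_ne_one hp (s := s) (by linarith)
  have hfac : 1 - ((p : ℂ) ^ (-s)) ^ 2 = (1 - (p : ℂ) ^ (-s)) * (1 + (p : ℂ) ^ (-s)) := by ring
  simp only [Subtype.mk.injEq, hsq, hfac, chiFour_natCast, liouvilleAP_prime 4 1 hp,
    ZMod.χ₄_nat_eq_if_mod_four, Nat.ModEq]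
  rcases hp.eq_two_or_odd with rfl | h
  · norm_num at hm hpl ⊢
    field_simp
  · have h2 : p ≠ 2 := by rintro rfl; omega
    have : p % 4 = 1 ∨ p % 4 = 3 := by omega
    rcases this with h' | h' <;> simp [h, h', h2]
    ring

lemma LSeries_liouvilleAP_eq {s : ℂ} (hs : 1 < s.re) :
    LSeries (fun n => (liouvilleAP 4 1 n : ℂ)) s =
      riemannZeta (2 * s) * (1 + (2 : ℂ) ^ (-s)) / DirichletCharacter.LFunction chiFour s := by
  rw [eq_div_iff (LFunction_chiFour_ne_zero_of_one_le_re hs.le),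
    LSeries_liouvilleAP_mul_LFunction hs]

lemma LSeriesHasSum_liouvilleAP {s : ℂ} (hs : 1 < s.re) :
    LSeriesHasSum (fun n => (liouvilleAP 4 1 n : ℂ)) s
      (riemannZeta (2 * s) * (1 + (2 : ℂ) ^ (-s)) / DirichletCharacter.LFunction chiFour s) := by
  rw [← LSeries_liouvilleAP_eq hs]
  exact (LSeriesSummable_liouvilleAP 4 1 hs).LSeriesHasSum

/-! ### A Tauberian theorem by Fourier analysis. -/

section Tauberian

open MeasureTheory Topology FourierTransform Real

variable {φ : ℝ → ℂ} {G : ℂ → ℂ} {ψ : ℝ → ℂ}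

lemma fourier_modulate (ψ : ℝ → ℂ) (y u : ℝ) :
    𝓕 (fun t : ℝ => Complex.exp (2 * π * y * t * Complex.I) * ψ t) u = 𝓕 ψ (u - y) := by
  rw [Real.fourier_real_eq_integral_exp_smul, Real.fourier_real_eq_integral_exp_smul]
  refine integral_congr_ae (Eventually.of_forall fun t => ?_)
  simp only [smul_eq_mul]
  rw [← mul_assoc, ← Complex.exp_add]
  congr 2
  push_cast
  ring

lemma fourier_comp_div (ψ : ℝ → ℂ) {c : ℝ} (hc : 0 < c) (u : ℝ) :
    𝓕 (fun t : ℝ => ψ (t / c)) u = c * 𝓕 ψ (c * u) := by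
  rw [Real.fourier_real_eq_integral_exp_smul, Real.fourier_real_eq_integral_exp_smul]
  have h := Measure.integral_comp_div
    (fun v : ℝ => Complex.exp (↑(-2 * π * v * (c * u)) * Complex.I) • ψ v) c
  rw [abs_of_pos hc, Complex.real_smul] at h
  rw [← h]
  refine integral_congr_ae (Eventually.of_forall fun t => ?_)
  simp only
  congr 4
  field_simp

lemma integral_fourier_mul_eq_integral_mul_fourier {f g : ℝ → ℂ} (hf : Integrable f)
    (hg : Integrable g) : ∫ u, 𝓕 f u * g u = ∫ t, f t * 𝓕 g t := by
  have h := VectorFourier.integral_fourierIntegral_smul_eq_flip (e := Real.fourierChar)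
    (L := innerₗ ℝ) (μ := volume) (ν := volume) (f := f) (g := g)
    Real.continuous_fourierChar continuous_inner hf hg
  rw [flip_innerₗ] at h
  exact h

lemma integrable_exp_neg_mul_of_bounded (hm : Measurable φ) (hb : ∀ u, ‖φ u‖ ≤ 1)
    (h0 : ∀ u < 0, φ u = 0) {ε : ℝ} (hε : 0 < ε) :
    Integrable (fun u : ℝ => Complex.exp (-ε * u) * φ u) := by
  have h1 : Integrable ((Set.Ici (0 : ℝ)).indicator fun u => Real.exp (-ε * u)) := by
    rw [integrable_indicator_iff measurableSet_Ici, integrableOn_Ici_iff_integrableOn_Ioi]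
    exact exp_neg_integrableOn_Ioi 0 hε
  refine h1.mono' (by fun_prop) (Eventually.of_forall fun u => ?_)
  rcases lt_or_ge u 0 with hu | hu
  · rw [h0 u hu, Set.indicator_of_notMem (by simpa using hu)]
    simp
  · rw [Set.indicator_of_mem (by simpa using hu), norm_mul, Complex.norm_exp]
    have : (-(ε : ℂ) * u).re = -ε * u := by simp
    rw [this]
    exact mul_le_of_le_one_right (Real.exp_pos _).le (hb u)

/-- The Laplace transform on `Re s = ε` is the Fourier transform of the damped function `e^{-εu}
φ(u)`; the multiplication formula `∫ f̂ g = ∫ f ĝ` moves the transform from `ψ` to it. -/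
lemma integral_fourier_sub_mul_exp (hm : Measurable φ) (hb : ∀ u, ‖φ u‖ ≤ 1)
    (h0 : ∀ u < 0, φ u = 0)
    (hL : ∀ s : ℂ, 0 < s.re → ∫ u : ℝ, Complex.exp (-s * u) * φ u = G s)
    (hψ : Integrable ψ) (y : ℝ) {ε : ℝ} (hε : 0 < ε) :
    ∫ u : ℝ, 𝓕 ψ (u - y) * (Complex.exp (-ε * u) * φ u) =
      ∫ t : ℝ, Complex.exp (2 * π * y * t * Complex.I) * ψ t * G (ε + 2 * π * t * Complex.I) := by
  simp_rw [← fourier_modulate ψ y]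
  rw [integral_fourier_mul_eq_integral_mul_fourier ?_
    (integrable_exp_neg_mul_of_bounded hm hb h0 hε)]
  · refine integral_congr_ae (Eventually.of_forall fun t => ?_)
    simp only
    congr 1
    rw [← hL _ (by simpa using hε), Real.fourier_real_eq_integral_exp_smul]
    refine integral_congr_ae (Eventually.of_forall fun u => ?_)
    simp only [smul_eq_mul]
    rw [← mul_assoc, ← Complex.exp_add]
    congr 2
    push_cast
    ring
  · refine hψ.norm.mono' (AEStronglyMeasurable.mul (by fun_prop) hψ.1)
      (Eventually.of_forall fun t => ?_)
    rw [norm_mul, Complex.norm_exp]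
    simp

/-- Let `ε → 0` by dominated convergence: on the left `|𝓕 ψ|` dominates, on the right the compact
support of `ψ` confines `G` to a compact set where it is bounded. -/
lemma integral_fourier_sub_mul (hm : Measurable φ) (hb : ∀ u, ‖φ u‖ ≤ 1)
    (h0 : ∀ u < 0, φ u = 0) (hG : ContinuousOn G {s | 0 ≤ s.re})
    (hL : ∀ s : ℂ, 0 < s.re → ∫ u : ℝ, Complex.exp (-s * u) * φ u = G s)
    (hψc : Continuous ψ) (hψs : HasCompactSupport ψ) (hK : Integrable (𝓕 ψ)) (y : ℝ) :
    ∫ u : ℝ, 𝓕 ψ (u - y) * φ u =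
      ∫ t : ℝ, Complex.exp (2 * π * y * t * Complex.I) * ψ t * G (2 * π * t * Complex.I) := by
  have hψ : Integrable ψ := hψc.integrable_of_hasCompactSupport hψs
  have hε : ∀ n : ℕ, (0 : ℝ) < 1 / (n + 1) := fun n => by positivity
  have hεlim : Tendsto (fun n : ℕ => (1 : ℝ) / (n + 1)) atTop (𝓝 0) :=
    tendsto_one_div_add_atTop_nhds_zero_nat
  have hεlimC : Tendsto (fun n : ℕ => (((1 : ℝ) / (n + 1) : ℝ) : ℂ)) atTop (𝓝 0) := by
    have := (Complex.continuous_ofReal.tendsto 0).comp hεlim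
    rwa [Complex.ofReal_zero] at this
  have hKy : Integrable (fun u => 𝓕 ψ (u - y)) := hK.comp_sub_right y
  have hGm : ∀ ε : ℝ, 0 ≤ ε → Continuous fun t : ℝ => G (ε + 2 * π * t * Complex.I) := by
    intro ε hε
    refine hG.comp_continuous (by fun_prop) fun t => ?_
    simpa using hε
  have hLHS : Tendsto (fun n : ℕ => ∫ u : ℝ, 𝓕 ψ (u - y) *
      (Complex.exp (-((1 : ℝ) / (n + 1) : ℝ) * u) * φ u)) atTop
      (𝓝 (∫ u : ℝ, 𝓕 ψ (u - y) * φ u)) := by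
    refine tendsto_integral_of_dominated_convergence (fun u => ‖𝓕 ψ (u - y)‖) (fun n => ?_)
      hKy.norm (fun n => Eventually.of_forall fun u => ?_) (Eventually.of_forall fun u => ?_)
    · exact hKy.1.mul (by fun_prop)
    · rw [norm_mul, norm_mul]
      refine mul_le_of_le_one_right (norm_nonneg _) ?_
      rcases lt_or_ge u 0 with hu | hu
      · simp [h0 u hu]
      · refine mul_le_one₀ ?_ (norm_nonneg _) (hb u)
        rw [Complex.norm_exp, Real.exp_le_one_iff, ← Complex.ofReal_neg, ← Complex.ofReal_mul,
          Complex.ofReal_re]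
        have := mul_nonneg (hε n).le hu
        linarith
    · refine Tendsto.const_mul _ ?_
      have : Tendsto (fun n : ℕ => Complex.exp (-((1 : ℝ) / (n + 1) : ℝ) * u)) atTop
          (𝓝 (Complex.exp (-0 * u))) :=
        (Complex.continuous_exp.tendsto _).comp (hεlimC.neg.mul_const _)
      simpa using this.mul_const (φ u)
  have hRHS : Tendsto (fun n : ℕ => ∫ t : ℝ, Complex.exp (2 * π * y * t * Complex.I) * ψ t *
      G (((1 : ℝ) / (n + 1) : ℝ) + 2 * π * t * Complex.I)) atTop
      (𝓝 (∫ t : ℝ, Complex.exp (2 * π * y * t * Complex.I) * ψ t *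
        G (2 * π * t * Complex.I))) := by
    have hcomp : IsCompact ((fun p : ℝ × ℝ => (p.1 + 2 * π * p.2 * Complex.I : ℂ)) ''
        (Set.Icc 0 1 ×ˢ tsupport ψ)) :=
      (isCompact_Icc.prod hψs).image (by fun_prop)
    obtain ⟨C, hC⟩ := hcomp.exists_bound_of_continuousOn (f := G) (hG.mono (by
      rintro _ ⟨p, hp, rfl⟩
      simpa using hp.1.1))
    refine tendsto_integral_of_dominated_convergence (fun t => ‖ψ t‖ * C) (fun n => ?_)
      (hψ.norm.mul_const C) (fun n => Eventually.of_forall fun t => ?_)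
      (Eventually.of_forall fun t => ?_)
    · exact (Continuous.mul (by fun_prop) (hGm _ (hε n).le)).aestronglyMeasurable
    · have h1 : ‖Complex.exp (2 * π * y * t * Complex.I)‖ = 1 := by
        rw [Complex.norm_exp]; simp
      rw [norm_mul, norm_mul, h1, one_mul]
      by_cases ht : t ∈ tsupport ψ
      · refine mul_le_mul_of_nonneg_left (hC _ ⟨(1 / (n + 1), t), ⟨⟨(hε n).le, ?_⟩, ht⟩, ?_⟩)
          (norm_nonneg _)
        · simp only
          rw [div_le_one (by positivity)]
          linarith [n.cast_nonneg (α := ℝ)]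
        · rfl
      · rw [image_eq_zero_of_notMem_tsupport ht]
        simp
    · refine Tendsto.const_mul _ ?_
      have hc : ContinuousWithinAt G {s | 0 ≤ s.re} (2 * π * t * Complex.I) :=
        hG _ (by simp)
      refine hc.tendsto.comp (tendsto_nhdsWithin_iff.mpr ⟨?_, Eventually.of_forall fun n => ?_⟩)
      · simpa using hεlimC.add_const (2 * π * t * Complex.I)
      · have h1 := (hε n).le
        rw [Set.mem_ofPred_eq, Complex.add_re, Complex.ofReal_re]
        simpa only [Complex.re_mul_ofReal, Complex.mul_I_re, ← Complex.ofReal_ofNat,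
          ← Complex.ofReal_mul, Complex.ofReal_im, neg_zero, add_zero] using h1
  refine tendsto_nhds_unique hLHS (hRHS.congr fun n => ?_)
  rw [integral_fourier_sub_mul_exp hm hb h0 hL hψ y (hε n)]

/-- This is the Riemann-Lebesgue lemma applied to `ψ(t) G(2πit)`. -/
lemma tendsto_integral_fourier_sub_mul (hm : Measurable φ) (hb : ∀ u, ‖φ u‖ ≤ 1)
    (h0 : ∀ u < 0, φ u = 0) (hG : ContinuousOn G {s | 0 ≤ s.re})
    (hL : ∀ s : ℂ, 0 < s.re → ∫ u : ℝ, Complex.exp (-s * u) * φ u = G s)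
    (hψc : Continuous ψ) (hψs : HasCompactSupport ψ) (hK : Integrable (𝓕 ψ)) :
    Tendsto (fun y : ℝ => ∫ u : ℝ, 𝓕 ψ (u - y) * φ u) atTop (𝓝 0) := by
  simp_rw [integral_fourier_sub_mul hm hb h0 hG hL hψc hψs hK]
  have h := (Real.tendsto_integral_exp_smul_cocompact
    (fun t : ℝ => ψ t * G (2 * π * t * Complex.I))).comp
      ((tendsto_neg_atTop_atBot (G := ℝ)).mono_right _root_.atBot_le_cocompact)
  refine h.congr fun y => integral_congr_ae (Eventually.of_forall fun t => ?_)
  simp only [Circle.smul_def, Real.fourierChar_apply, smul_eq_mul]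
  rw [← mul_assoc]
  congr 3
  push_cast
  ring

/-- A Tauberian theorem of Wiener-Ikehara type: a bounded slowly varying function whose Laplace
transform extends continuously to the closed half-plane tends to zero. -/
theorem tendsto_zero_of_laplace_continuousOn (hm : Measurable φ) (hb : ∀ u, ‖φ u‖ ≤ 1)
    (h0 : ∀ u < 0, φ u = 0) (hG : ContinuousOn G {s | 0 ≤ s.re})
    (hL : ∀ s : ℂ, 0 < s.re → ∫ u : ℝ, Complex.exp (-s * u) * φ u = G s)
    (hslow : ∀ y h : ℝ, 0 ≤ y → ‖φ (y + h) - φ y‖ ≤ 2 * |h| + Real.exp (-y)) :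
    Tendsto φ atTop (𝓝 0) := by
  let b : ContDiffBump (0 : ℝ) := ⟨1, 2, one_pos, one_lt_two⟩
  have hbs : HasCompactSupport (fun t : ℝ => (b t : ℂ)) :=
    b.hasCompactSupport.comp_left Complex.ofReal_zero
  have hbd : ContDiff ℝ (⊤ : ℕ∞) (fun t : ℝ => (b t : ℂ)) :=
    Complex.ofRealCLM.contDiff.comp b.contDiff
  let Ψ : SchwartzMap ℝ ℂ := hbs.toSchwartzMap hbd
  set ψ : ℝ → ℂ := fun t : ℝ => (b t : ℂ) with hψdef
  have hΨ : ∀ u, (𝓕 Ψ) u = 𝓕 ψ u := fun u => by rw [SchwartzMap.fourier_coe]; rfl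
  have hKint : Integrable (𝓕 ψ) := (𝓕 Ψ).integrable.congr (Eventually.of_forall hΨ)
  have hKint1 : Integrable (fun u => |u| * ‖𝓕 ψ u‖) := by
    have := (𝓕 Ψ).integrable_pow_mul volume 1
    refine this.congr (Eventually.of_forall fun u => ?_)
    simp [hΨ]
  have hψc : Continuous ψ := hbd.continuous
  -- Fourier inversion at 0, where the bump equals 1: `𝓕 ψ` is a kernel of mass one.
  have hone : ∫ u, 𝓕 ψ u = 1 := by
    have h := congrFun (hψc.fourierInv_fourier_eq
      (hψc.integrable_of_hasCompactSupport hbs) hKint) 0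
    rw [Real.fourierInv_eq'] at h
    simpa [hψdef, b.one_of_mem_closedBall (x := (0 : ℝ)) (by simp [b])] using h
  set A := ∫ u, |u| * ‖𝓕 ψ u‖ with hA
  set B := ∫ u, ‖𝓕 ψ u‖ with hB
  have hA0 : 0 ≤ A := integral_nonneg fun u => by positivity
  -- Dilating `ψ` by `c` concentrates the kernel at scale `1/c`. Slow variation then bounds the gap
  -- between `φ y` and its average by the first absolute moment `A` over `c`, plus a term vanishing
  -- as `y → ∞`.
  have key : ∀ c : ℝ, 0 < c → ∀ y : ℝ, 0 ≤ y →
      ‖φ y‖ ≤ ‖∫ u : ℝ, 𝓕 (fun t : ℝ => ψ (t / c)) (u - y) * φ u‖ +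
        (2 / c * A + Real.exp (-y) * B) := by
    intro c hc y hy
    have h1 : ∫ u : ℝ, 𝓕 (fun t : ℝ => ψ (t / c)) (u - y) * φ u =
        ∫ v : ℝ, 𝓕 ψ v * φ (y + v / c) := by
      simp_rw [fourier_comp_div ψ hc]
      rw [← integral_add_right_eq_self _ y]
      have h := Measure.integral_comp_mul_left (fun v : ℝ => 𝓕 ψ v * φ (y + v / c)) c
      rw [abs_of_pos (inv_pos.mpr hc), Complex.real_smul] at h
      have h2 : ∫ v : ℝ, 𝓕 ψ v * φ (y + v / c) =
          c * ∫ x : ℝ, 𝓕 ψ (c * x) * φ (y + c * x / c) := by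
        rw [h, ← mul_assoc, ← Complex.ofReal_mul, mul_inv_cancel₀ hc.ne']
        simp
      rw [h2, ← integral_const_mul]
      refine integral_congr_ae (Eventually.of_forall fun t => ?_)
      simp only [add_sub_cancel_right, mul_div_cancel_left₀ _ hc.ne']
      rw [add_comm y t]
      ring
    have hi1 : Integrable (fun v => 𝓕 ψ v * φ (y + v / c)) := by
      refine hKint.norm.mono' (hKint.1.mul (Measurable.aestronglyMeasurable (by fun_prop)))
        (Eventually.of_forall fun v => ?_)
      rw [norm_mul]
      exact mul_le_of_le_one_right (norm_nonneg _) (hb _)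
    have hi2 : Integrable (fun v => 𝓕 ψ v * φ y) := hKint.mul_const _
    have h3 : φ y = (∫ v : ℝ, 𝓕 ψ v * φ (y + v / c)) -
        ∫ v : ℝ, 𝓕 ψ v * (φ (y + v / c) - φ y) := by
      rw [← integral_sub hi1 ((hi1.sub hi2).congr (Eventually.of_forall fun v => (mul_sub _ _ _).symm))]
      simp_rw [mul_sub, sub_sub_cancel]
      rw [integral_mul_const, hone, one_mul]
    have h4 : ‖∫ v : ℝ, 𝓕 ψ v * (φ (y + v / c) - φ y)‖ ≤ 2 / c * A + Real.exp (-y) * B := by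
      rw [hA, hB, ← integral_const_mul, ← integral_const_mul,
        ← integral_add (hKint1.const_mul _) (hKint.norm.const_mul _)]
      refine norm_integral_le_of_norm_le
        ((hKint1.const_mul _).add (hKint.norm.const_mul _)) (Eventually.of_forall fun v => ?_)
      rw [norm_mul]
      calc ‖𝓕 ψ v‖ * ‖φ (y + v / c) - φ y‖ ≤ ‖𝓕 ψ v‖ * (2 * |v / c| + Real.exp (-y)) := by
            gcongr; exact hslow y _ hy
        _ = _ := by rw [abs_div, abs_of_pos hc]; ring
    rw [h1]
    calc ‖φ y‖ = _ := congrArg norm h3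
      _ ≤ _ := norm_sub_le _ _
      _ ≤ _ := by gcongr
  rw [Metric.tendsto_atTop']
  intro ε hε
  -- The scale `c` is fixed first, to make the moment term small; only then does `y` tend to
  -- infinity.
  obtain ⟨c, hc, hcA⟩ : ∃ c : ℝ, 0 < c ∧ 2 / c * A < ε / 3 := by
    refine ⟨6 * (A + 1) / ε, by positivity, ?_⟩
    rw [div_div_eq_mul_div, div_mul_eq_mul_div, div_lt_iff₀ (by positivity)]
    nlinarith
  have hψcc : Continuous (fun t : ℝ => ψ (t / c)) := by fun_prop
  have hψcs : HasCompactSupport (fun t : ℝ => ψ (t / c)) := by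
    have := hbs.comp_homeomorph (Homeomorph.mulRight₀ c⁻¹ (by positivity))
    simpa [Function.comp_def, div_eq_mul_inv] using this
  have hKc : Integrable (𝓕 (fun t : ℝ => ψ (t / c))) := by
    rw [show 𝓕 (fun t : ℝ => ψ (t / c)) = fun u => (c : ℂ) * 𝓕 ψ (c * u) from
      funext (fourier_comp_div ψ hc)]
    exact (hKint.comp_mul_left' hc.ne').const_mul _
  have hlim1 := (tendsto_integral_fourier_sub_mul hm hb h0 hG hL hψcc hψcs hKc).norm
  have hlim2 : Tendsto (fun y : ℝ => Real.exp (-y) * B) atTop (𝓝 0) := by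
    simpa using (Real.tendsto_exp_neg_atTop_nhds_zero).mul_const B
  rw [norm_zero] at hlim1
  have hev := ((hlim1.eventually_lt_const (show (0 : ℝ) < ε / 3 by positivity)).and
    (hlim2.eventually_lt_const (show (0 : ℝ) < ε / 3 by positivity))).and
      (eventually_ge_atTop (0 : ℝ))
  obtain ⟨N, hN⟩ := eventually_atTop.mp hev
  refine ⟨N, fun y hy => ?_⟩
  obtain ⟨⟨h1, h2⟩, h3⟩ := hN y hy.le
  rw [dist_zero_right]
  linarith [key c hc y h3]

end Tauberian

/-! ### The bound `o(x)` for `λ(n;4,1)`. -/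

section Unconditional

open MeasureTheory Topology

lemma abs_liouvilleAPSum_sub_le (q a : ℕ) {x y : ℝ} (hx : 0 ≤ x) (hxy : x ≤ y) :
    |liouvilleAPSum q a y - liouvilleAPSum q a x| ≤ y - x + 1 := by
  have hfl : ⌊x⌋₊ ≤ ⌊y⌋₊ := Nat.floor_mono hxy
  unfold liouvilleAPSum
  rw [← Finset.sum_sdiff (Finset.Icc_subset_Icc_right hfl), add_sub_cancel_right]
  calc _ ≤ ∑ n ∈ Finset.Icc 1 ⌊y⌋₊ \ Finset.Icc 1 ⌊x⌋₊, |(liouvilleAP q a n : ℝ)| :=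
        Finset.abs_sum_le_sum_abs _ _
    _ = ((Finset.Icc 1 ⌊y⌋₊ \ Finset.Icc 1 ⌊x⌋₊).card : ℝ) := by simp [abs_liouvilleAP]
    _ = ⌊y⌋₊ - ⌊x⌋₊ := by
        rw [Finset.card_sdiff_of_subset (Finset.Icc_subset_Icc_right hfl)]
        simp [Nat.cast_sub hfl]
    _ ≤ y - x + 1 := by
        linarith [Nat.floor_le (hx.trans hxy), Nat.lt_floor_add_one x]

lemma liouvilleAPSum_eq_zero (q a : ℕ) {x : ℝ} (hx : x < 1) : liouvilleAPSum q a x = 0 := by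
  simp [liouvilleAPSum, Nat.floor_eq_zero.mpr hx]

lemma abs_liouvilleAPSum_le (q a : ℕ) {x : ℝ} (hx : 0 ≤ x) : |liouvilleAPSum q a x| ≤ x := by
  unfold liouvilleAPSum
  calc _ ≤ ∑ n ∈ Finset.Icc 1 ⌊x⌋₊, |(liouvilleAP q a n : ℝ)| := Finset.abs_sum_le_sum_abs _ _
    _ = ⌊x⌋₊ := by simp [abs_liouvilleAP]
    _ ≤ x := Nat.floor_le hx

lemma measurable_liouvilleAPSum (q a : ℕ) : Measurable (liouvilleAPSum q a) := by
  have : liouvilleAPSum q a =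
      (fun n : ℕ => ∑ k ∈ Finset.Icc 1 n, (liouvilleAP q a k : ℝ)) ∘ fun x : ℝ => ⌊x⌋₊ := rfl
  rw [this]
  exact (measurable_from_top).comp Nat.measurable_floor

/-- The normalised summatory function `L(e^u;q,a) e^{-u}`. -/
noncomputable def liouvilleAPMean (q a : ℕ) (u : ℝ) : ℝ :=
  liouvilleAPSum q a (Real.exp u) / Real.exp u

lemma abs_liouvilleAPMean_le (q a : ℕ) (u : ℝ) : |liouvilleAPMean q a u| ≤ 1 := by
  rw [liouvilleAPMean, abs_div, abs_of_pos (Real.exp_pos u), div_le_one (Real.exp_pos u)]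
  exact abs_liouvilleAPSum_le q a (Real.exp_pos u).le

lemma liouvilleAPMean_eq_zero (q a : ℕ) {u : ℝ} (hu : u < 0) : liouvilleAPMean q a u = 0 := by
  rw [liouvilleAPMean, liouvilleAPSum_eq_zero q a (Real.exp_lt_one_iff.mpr hu), zero_div]

/-- The inequality `1 - e^{u-v} ≤ v - u` is used twice, for the newly counted terms and for the
change of normaliser. The extra `exp (-v)` is the rounding error 1 in counting integers, divided by
`e^v`. -/
lemma abs_liouvilleAPMean_sub_le_of_le (q a : ℕ) {u v : ℝ} (huv : u ≤ v) :
    |liouvilleAPMean q a v - liouvilleAPMean q a u| ≤ 2 * (v - u) + Real.exp (-v) := by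
  have hu := Real.exp_pos u
  have hv := Real.exp_pos v
  have h1 := abs_liouvilleAPSum_sub_le q a hu.le (Real.exp_le_exp.mpr huv)
  have h2 := abs_liouvilleAPMean_le q a u
  have h3 : Real.exp u / Real.exp v ≥ 1 - (v - u) := by
    rw [← Real.exp_sub]
    linarith [Real.add_one_le_exp (u - v)]
  have h4 : Real.exp u / Real.exp v ≤ 1 := by
    rw [div_le_one hv]; exact Real.exp_le_exp.mpr huv
  have h5 : liouvilleAPMean q a v - liouvilleAPMean q a u =
      (liouvilleAPSum q a (Real.exp v) - liouvilleAPSum q a (Real.exp u)) / Real.exp v -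
        liouvilleAPMean q a u * (1 - Real.exp u / Real.exp v) := by
    unfold liouvilleAPMean
    field_simp
    ring
  rw [h5]
  refine (abs_sub _ _).trans ?_
  rw [abs_div, abs_of_pos hv, abs_mul, abs_of_nonneg (sub_nonneg.mpr h4)]
  calc _ ≤ (Real.exp v - Real.exp u + 1) / Real.exp v + 1 * (1 - Real.exp u / Real.exp v) := by
        gcongr
    _ = 2 * (1 - Real.exp u / Real.exp v) + Real.exp (-v) := by
        rw [Real.exp_neg]; field_simp; ring
    _ ≤ _ := by linarith

lemma abs_liouvilleAPMean_sub_le (q a : ℕ) (y h : ℝ) :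
    |liouvilleAPMean q a (y + h) - liouvilleAPMean q a y| ≤ 2 * |h| + Real.exp (-y) := by
  rcases le_total 0 h with hh | hh
  · refine (abs_liouvilleAPMean_sub_le_of_le q a (by linarith)).trans ?_
    rw [abs_of_nonneg hh]
    have : Real.exp (-(y + h)) ≤ Real.exp (-y) := Real.exp_le_exp.mpr (by linarith)
    linarith
  · rw [abs_sub_comm]
    refine (abs_liouvilleAPMean_sub_le_of_le q a (by linarith)).trans ?_
    rw [abs_of_nonpos hh]
    linarith

/-- Abel summation followed by the substitution `t = e^u`; negative `u` contribute nothing, since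
the sum is empty below 1. -/
lemma integral_exp_mul_liouvilleAPMean (q a : ℕ) {s : ℂ} (hs : 0 < s.re) :
    ∫ u : ℝ, Complex.exp (-s * u) * (liouvilleAPMean q a u : ℂ) =
      LSeries (fun n => (liouvilleAP q a n : ℂ)) (1 + s) / (1 + s) := by
  have hs1 : 1 < (1 + s).re := by simpa using hs
  have himage : Real.exp '' Set.Ioi 0 = Set.Ioi 1 := by
    ext x
    constructor
    · rintro ⟨u, hu, rfl⟩
      exact Real.one_lt_exp_iff.mpr hu
    · intro hx
      exact ⟨Real.log x, Real.log_pos hx, Real.exp_log (lt_trans one_pos hx)⟩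
  rw [LSeries_eq_mul_integral' _ zero_le_one hs1 (by simpa only [norm_liouvilleAP, Finset.sum_const, Nat.card_Icc, add_tsub_cancel_right,
      nsmul_eq_mul, mul_one, Real.rpow_one] using isBigO_refl (fun n : ℕ => (n : ℝ)) atTop),
    mul_div_cancel_left₀ _ (Complex.ne_zero_of_one_lt_re hs1), ← himage,
    integral_image_eq_integral_abs_deriv_smul measurableSet_Ioi
      (fun x _ => (Real.hasDerivAt_exp x).hasDerivWithinAt) Real.exp_injective.injOn,
    ← integral_Ici_eq_integral_Ioi, setIntegral_eq_integral_of_forall_compl_eq_zero]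
  · refine integral_congr_ae (Eventually.of_forall fun u => ?_)
    have hne : (Real.exp u : ℂ) ≠ 0 := by exact_mod_cast (Real.exp_pos u).ne'
    have hpow : (Real.exp u : ℂ) ^ (-(1 + s + 1)) =
        Complex.exp (-s * u) * ((Real.exp u : ℂ))⁻¹ * ((Real.exp u : ℂ))⁻¹ := by
      rw [Complex.cpow_def_of_ne_zero hne, ← Complex.ofReal_log (Real.exp_pos u).le, Real.log_exp,
        Complex.ofReal_exp, ← Complex.exp_neg, ← Complex.exp_add, ← Complex.exp_add]
      congr 1
      ring
    simp only [liouvilleAPMean, liouvilleAPSum, hpow, abs_of_pos (Real.exp_pos u),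
      Complex.real_smul]
    push_cast
    rw [← Complex.ofReal_exp]
    field_simp
  · intro u hu
    have : ⌊Real.exp u⌋₊ = 0 := Nat.floor_eq_zero.mpr (Real.exp_lt_one_iff.mpr (by simpa using hu))
    simp [this]

lemma differentiable_LFunction_chiFour :
    Differentiable ℂ (DirichletCharacter.LFunction chiFour) :=
  DirichletCharacter.differentiable_LFunction chiFour_ne_one

/-- The analytic continuation of the Dirichlet series of `λ(n;4,1)`. -/
noncomputable def liouvilleLFunction (s : ℂ) : ℂ :=
  riemannZeta (2 * s) * (1 + (2 : ℂ) ^ (-s)) / DirichletCharacter.LFunction chiFour s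

lemma differentiableAt_liouvilleLFunction {s : ℂ} (hs : 1 / 2 < s.re)
    (hL : DirichletCharacter.LFunction chiFour s ≠ 0) :
    DifferentiableAt ℂ liouvilleLFunction s := by
  have h2 : 2 * s ≠ 1 := by
    intro h
    have := congrArg Complex.re h
    simp at this
    linarith
  have h3 : DifferentiableAt ℂ (fun s : ℂ => riemannZeta (2 * s)) s :=
    (differentiableAt_riemannZeta h2).comp s (by fun_prop)
  have h4 : DifferentiableAt ℂ (fun s : ℂ => 1 + (2 : ℂ) ^ (-s)) s := by
    refine DifferentiableAt.const_add _ (DifferentiableAt.const_cpow (by fun_prop) (by simp))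
  exact (h3.mul h4).div differentiable_LFunction_chiFour.differentiableAt hL

lemma tendsto_liouvilleAPMean_four_one :
    Tendsto (fun u => (liouvilleAPMean 4 1 u : ℂ)) atTop (𝓝 0) := by
  refine tendsto_zero_of_laplace_continuousOn
    (G := fun s => liouvilleLFunction (1 + s) / (1 + s)) ?_ (fun u => ?_) (fun u hu => ?_) ?_
    (fun s hs => ?_) (fun y h _ => ?_)
  · exact Complex.measurable_ofReal.comp
      (((measurable_liouvilleAPSum 4 1).comp Real.measurable_exp).div Real.measurable_exp)
  · rw [Complex.norm_real]
    exact abs_liouvilleAPMean_le 4 1 u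
  · rw [liouvilleAPMean_eq_zero 4 1 hu, Complex.ofReal_zero]
  · intro s hs
    have hs1 : 1 ≤ (1 + s).re := by simpa using hs
    have h1 : ContinuousAt (fun s => liouvilleLFunction (1 + s)) s :=
      ContinuousAt.comp (g := liouvilleLFunction)
        (differentiableAt_liouvilleLFunction (by linarith)
          (LFunction_chiFour_ne_zero_of_one_le_re hs1)).continuousAt (by fun_prop)
    have h2 : 1 + s ≠ 0 := by
      intro h
      rw [h] at hs1
      simp at hs1
      linarith
    exact (h1.div (by fun_prop) h2).continuousWithinAt
  · rw [integral_exp_mul_liouvilleAPMean 4 1 hs, LSeries_liouvilleAP_eq (by simpa using hs)]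
    rfl
  · rw [← Complex.ofReal_sub, Complex.norm_real]
    exact abs_liouvilleAPMean_sub_le 4 1 y h

lemma liouvilleAPSum_four_one_isLittleO :
    (fun x : ℝ => liouvilleAPSum 4 1 x) =o[atTop] (fun x : ℝ => x) := by
  have h1 : Tendsto (fun u => liouvilleAPMean 4 1 u) atTop (𝓝 0) := by
    rw [tendsto_zero_iff_norm_tendsto_zero]
    simpa using tendsto_liouvilleAPMean_four_one.norm
  rw [isLittleO_iff_tendsto' (by filter_upwards [eventually_ne_atTop 0] with x hx h using absurd h hx)]
  refine (h1.comp Real.tendsto_log_atTop).congr' ?_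
  filter_upwards [eventually_gt_atTop 0] with x hx
  simp [liouvilleAPMean, Real.exp_log hx]

end Unconditional

/-! ### Linear growth of `L(s,χ₄)` on `Re s > 0`. -/

section LFunctionBound

open MeasureTheory Topology

/-- The partial sums of `χ₄`. -/
noncomputable def chiFourSum (t : ℝ) : ℂ := ∑ k ∈ Finset.Icc 1 ⌊t⌋₊, chiFour (k : ZMod 4)

lemma norm_sum_chiFour_le (n : ℕ) : ‖∑ k ∈ Finset.Icc 1 n, chiFour (k : ZMod 4)‖ ≤ 1 := by
  simp_rw [chiFour_natCast]
  rw [← Int.cast_sum, sum_chi_four]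
  split_ifs <;> simp

lemma norm_chiFourSum_le (t : ℝ) : ‖chiFourSum t‖ ≤ 1 := norm_sum_chiFour_le _

lemma chiFourSum_eq_zero {t : ℝ} (ht : t < 1) : chiFourSum t = 0 := by
  simp [chiFourSum, Nat.floor_eq_zero.mpr ht]

lemma measurable_chiFourSum : Measurable chiFourSum := by
  have : chiFourSum =
      (fun n : ℕ => ∑ k ∈ Finset.Icc 1 n, chiFour (k : ZMod 4)) ∘ fun x : ℝ => ⌊x⌋₊ := rfl
  rw [this]
  exact (measurable_from_top).comp Nat.measurable_floor

lemma differentiableAt_mellin_chiFourSum {s : ℂ} (hs : 0 < s.re) :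
    DifferentiableAt ℂ (fun s => mellin chiFourSum (-s)) s := by
  have h : DifferentiableAt ℂ (mellin chiFourSum) (-s) := by
    -- `a = 0` expresses boundedness at infinity. Since `chiFourSum` vanishes near 0, any `b` below
    -- `-s.re` would serve.
    refine mellin_differentiableAt_of_isBigO_rpow (a := 0) (b := -s.re - 1) ?_ ?_
      (by simpa using hs) ?_ (by simp)
    · refine LocallyIntegrable.locallyIntegrableOn ?_ _
      refine (locallyIntegrable_const (1 : ℂ)).mono measurable_chiFourSum.aestronglyMeasurable
        (Eventually.of_forall fun t => ?_)
      simpa using norm_chiFourSum_le t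
    · refine IsBigO.of_bound 1 (Eventually.of_forall fun t => ?_)
      simpa using norm_chiFourSum_le t
    · refine IsBigO.of_bound 1 ?_
      filter_upwards [mem_nhdsWithin_of_mem_nhds (gt_mem_nhds one_pos)] with t ht
      rw [chiFourSum_eq_zero ht]
      simp
  exact h.comp s differentiable_neg.differentiableAt

/-- Abel summation proves this for `Re s > 1`; both sides are analytic on `Re s > 0`, so the
identity theorem extends it. -/
lemma LFunction_chiFour_eq_mellin {s : ℂ} (hs : 0 < s.re) :
    DirichletCharacter.LFunction chiFour s = s * mellin chiFourSum (-s) := by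
  have hopen : IsOpen {s : ℂ | 0 < s.re} := isOpen_lt continuous_const Complex.continuous_re
  have hconn : IsPreconnected {s : ℂ | 0 < s.re} :=
    (convex_halfSpace_re_gt 0).isPreconnected
  have h1 : AnalyticOnNhd ℂ (DirichletCharacter.LFunction chiFour) {s : ℂ | 0 < s.re} :=
    (differentiable_LFunction_chiFour.differentiableOn).analyticOnNhd hopen
  have h2 : AnalyticOnNhd ℂ (fun s => s * mellin chiFourSum (-s)) {s : ℂ | 0 < s.re} := by
    refine DifferentiableOn.analyticOnNhd (fun z hz => ?_) hopen
    exact (differentiableAt_id.mul (differentiableAt_mellin_chiFourSum hz)).differentiableWithinAt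
  have h3 : (DirichletCharacter.LFunction chiFour) =ᶠ[𝓝 (2 : ℂ)]
      (fun s => s * mellin chiFourSum (-s)) := by
    have : {z : ℂ | 1 < z.re} ∈ 𝓝 (2 : ℂ) :=
      (isOpen_lt continuous_const Complex.continuous_re).mem_nhds (by simp)
    filter_upwards [this] with z hz
    rw [DirichletCharacter.LFunction_eq_LSeries chiFour hz, LSeries_eq_mul_integral _ le_rfl
      (lt_trans one_pos hz) (DirichletCharacter.LSeriesSummable_of_one_lt_re chiFour hz)
      (IsBigO.of_bound 1 (Eventually.of_forall fun n => by simpa using norm_sum_chiFour_le n)),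
      mellin]
    congr 1
    rw [← integral_Ici_eq_integral_Ioi]
    refine (setIntegral_congr_fun measurableSet_Ici fun t _ => ?_).trans
      (setIntegral_eq_of_subset_of_forall_sdiff_eq_zero (s := Set.Ici 1) (t := Set.Ioi 0)
        (f := fun t : ℝ => (t : ℂ) ^ (-z - 1) • chiFourSum t) measurableSet_Ioi
        (fun t ht => Set.mem_Ioi.mpr (lt_of_lt_of_le one_pos ht)) (fun t ht => ?_)).symm
    · simp only [chiFourSum, smul_eq_mul]
      rw [mul_comm, neg_add']
    · simp [chiFourSum_eq_zero (not_le.mp ht.2)]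
  exact h1.eqOn_of_preconnected_of_eventuallyEq h2 hconn (z₀ := 2) (by simp) h3 hs

/-- The partial sums are bounded by 1 and vanish below 1, so the Mellin integral is at most `∫_1^∞
t^{-Re s - 1} dt = 1 / Re s`. -/
lemma norm_LFunction_chiFour_le {s : ℂ} (hs : 0 < s.re) :
    ‖DirichletCharacter.LFunction chiFour s‖ ≤ ‖s‖ / s.re := by
  rw [LFunction_chiFour_eq_mellin hs, norm_mul, div_eq_mul_inv]
  gcongr
  rw [mellin, setIntegral_eq_of_subset_of_forall_sdiff_eq_zero (s := Set.Ici 1) measurableSet_Ioi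
    (fun t ht => lt_of_lt_of_le one_pos ht)
    (fun t ht => by simp [chiFourSum_eq_zero (not_le.mp ht.2)]), integral_Ici_eq_integral_Ioi]
  have hlt : -s.re - 1 < -1 := by linarith
  have h := integral_Ioi_rpow_of_lt hlt one_pos
  have h2 : ∫ t in Set.Ioi (1 : ℝ), t ^ (-s.re - 1) = (s.re)⁻¹ := by
    rw [h, Real.one_rpow, sub_add_cancel, div_neg, neg_div, neg_neg, one_div]
  rw [← h2]
  refine norm_integral_le_of_norm_le (integrableOn_Ioi_rpow_of_lt hlt one_pos) ?_
  filter_upwards [ae_restrict_mem measurableSet_Ioi] with t ht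
  rw [norm_smul, Complex.norm_cpow_eq_rpow_re_of_pos (lt_trans one_pos ht)]
  simp only [Complex.sub_re, Complex.neg_re, Complex.one_re]
  exact mul_le_of_le_one_right (Real.rpow_nonneg (lt_trans one_pos ht).le _)
    (norm_sum_chiFour_le _)

end LFunctionBound

/-! ### Holomorphic logarithms on half-planes. -/

section Littlewood

open Topology

/-- A nonvanishing holomorphic function on the half-plane `Re s > a` has a holomorphic logarithm,
normalised to agree with a given one on `Re s > b`. -/
lemma exists_log_halfPlane {L H : ℂ → ℂ} {a b : ℝ} (hab : a ≤ b)
    (hL : DifferentiableOn ℂ L {s | a < s.re}) (hL0 : ∀ s : ℂ, a < s.re → L s ≠ 0)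
    (hH : ContinuousOn H {s | b < s.re}) (hexp : ∀ s : ℂ, b < s.re → Complex.exp (H s) = L s) :
    ∃ F : ℂ → ℂ, DifferentiableOn ℂ F {s | a < s.re} ∧
      (∀ s : ℂ, a < s.re → Complex.exp (F s) = L s) ∧ ∀ s : ℂ, b < s.re → F s = H s := by
  have hopen : IsOpen {s : ℂ | a < s.re} := isOpen_lt continuous_const Complex.continuous_re
  have : ContractibleSpace {s : ℂ | a < s.re} :=
    (convex_halfSpace_re_gt a).contractibleSpace ⟨(a + 1 : ℝ), by simp⟩
  have hsc : IsSimplyConnected {s : ℂ | a < s.re} :=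
    (inferInstance : SimplyConnectedSpace {s : ℂ | a < s.re})
  have hne : 0 ∉ L '' {s : ℂ | a < s.re} := by
    rintro ⟨s, hs, h⟩
    exact hL0 s hs h
  obtain ⟨F, hFc, hF⟩ := Complex.exists_continuousOn_eqOn_exp_comp hsc hopen hL.continuousOn hne
  have hFexp : ∀ s : ℂ, a < s.re → Complex.exp (F s) = L s := fun s hs => hF hs
  have hFd : DifferentiableOn ℂ F {s | a < s.re} := by
    intro s hs
    have hFs : ContinuousAt F s := hFc.continuousAt (hopen.mem_nhds hs)
    have hnear : ∀ᶠ z in 𝓝 s, |(F z - F s).im| < Real.pi := by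
      have : ContinuousAt (fun z => |(F z - F s).im|) s := by fun_prop
      refine this.eventually_lt_const ?_
      simpa using Real.pi_pos
    -- A continuous logarithm is locally a translate of the principal one, hence holomorphic.
    have heq : F =ᶠ[𝓝 s] fun z => Complex.log (L z / L s) + F s := by
      filter_upwards [hnear, hopen.mem_nhds hs] with z hz hza
      rw [← hFexp z hza, ← hFexp s hs, ← Complex.exp_sub, Complex.log_exp
        (neg_lt_of_abs_lt hz) (le_of_abs_le hz.le), sub_add_cancel]
    refine (DifferentiableAt.congr_of_eventuallyEq ?_ heq).differentiableWithinAt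
    refine DifferentiableAt.add_const _ (DifferentiableAt.clog ?_ ?_)
    · exact ((hL s hs).differentiableAt (hopen.mem_nhds hs)).div_const _
    · rw [div_self (hL0 s hs)]
      exact Complex.one_mem_slitPlane
  let z₀ : ℂ := (b + 1 : ℝ)
  have hz₀ : b < z₀.re := by simp [z₀]
  have hconn : IsPreconnected {s : ℂ | b < s.re} := (convex_halfSpace_re_gt b).isPreconnected
  have hmono : ∀ s : ℂ, b < s.re → a < s.re := fun s hs => lt_of_le_of_lt hab hs
  -- `(F - H) / 2πi` is continuous and integer valued
  have hint : ∀ s ∈ {s : ℂ | b < s.re},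
      ∃ n : ℤ, F s - H s = n * (2 * Real.pi * Complex.I) := by
    intro s hs
    rw [← Complex.exp_eq_one_iff, Complex.exp_sub, hFexp s (hmono s hs), hexp s hs,
      div_self (hL0 s (hmono s hs))]
  have hconst : ∀ s : ℂ, b < s.re → F s - H s = F z₀ - H z₀ := by
    intro s hs
    choose! k hk using hint
    have hcont : ContinuousOn (fun s => ((F s - H s) / (2 * Real.pi * Complex.I)).re)
        {s : ℂ | b < s.re} :=
      Complex.continuous_re.comp_continuousOn
        (((hFc.mono fun s hs => hmono s hs).sub hH).div_const _)
    have hkc : ContinuousOn k {s : ℂ | b < s.re} := by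
      rw [Int.isClosedEmbedding_coe_real.isInducing.continuousOn_iff]
      refine hcont.congr fun s hs => ?_
      simp only [Function.comp_apply]
      rw [hk s hs, mul_div_cancel_right₀ _ Complex.two_pi_I_ne_zero]
      simp
    rw [hk s hs, hk z₀ hz₀, hconn.constant hkc hs hz₀]
  refine ⟨fun s => F s - (F z₀ - H z₀), hFd.sub_const _, fun s hs => ?_, fun s hs => ?_⟩
  · obtain ⟨n, hn⟩ := hint z₀ hz₀
    rw [Complex.exp_sub, hFexp s hs, hn, Complex.exp_int_mul_two_pi_mul_I, div_one]
  · simp only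
    rw [← hconst s hs]
    ring

end Littlewood

/-! ### Growth of the logarithm in the critical strip. -/

section Littlewood

/-- The shift 8 makes the logarithm at least 1, and `8 + 2|t|` also dominates the bound `7 + 2|t|`
for `L` on the disc used in `norm_log_le_of_norm_le`. -/
lemma one_le_log_eight_add (t : ℝ) : 1 ≤ Real.log (8 + 2 * |t|) := by
  rw [Real.le_log_iff_exp_le (by positivity)]
  linarith [Real.exp_one_lt_d9, abs_nonneg t]

/-- Separates the height `t` from the displacement `y`; the factor `1 + |y|` is later absorbed by a
Gaussian. -/
lemma log_eight_add_le (t y : ℝ) :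
    Real.log (8 + 2 * |y + t|) ≤ Real.log (8 + 2 * |t|) * (1 + |y|) := by
  have h1 := one_le_log_eight_add t
  calc Real.log (8 + 2 * |y + t|) ≤ Real.log ((8 + 2 * |t|) * (1 + |y|)) := by
        apply Real.log_le_log (by positivity)
        nlinarith [abs_add_le y t, abs_nonneg t, abs_nonneg y, mul_nonneg (abs_nonneg t) (abs_nonneg y)]
    _ = Real.log (8 + 2 * |t|) + Real.log (1 + |y|) :=
        Real.log_mul (by positivity) (by positivity)
    _ ≤ Real.log (8 + 2 * |t|) + |y| := by
        linarith [Real.log_le_sub_one_of_pos (show 0 < 1 + |y| by positivity)]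
    _ ≤ _ := by nlinarith [abs_nonneg y]

lemma one_add_abs_mul_exp_neg_sq_le (y : ℝ) : (1 + |y|) * Real.exp (-y ^ 2) ≤ 2 := by
  rw [Real.exp_neg, ← div_eq_mul_inv, div_le_iff₀ (Real.exp_pos _)]
  have h1 := Real.add_one_le_exp (y ^ 2)
  nlinarith [sq_nonneg (|y| - 1), sq_abs y]

/-- The Borel-Carathéodory bound for a logarithm of a function of at most linear growth. -/
lemma norm_log_le_of_norm_le {F L : ℂ → ℂ} (hF : DifferentiableOn ℂ F {s | 1 / 2 < s.re})
    (hFL : ∀ s : ℂ, 1 / 2 < s.re → Complex.exp (F s) = L s)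
    (hL : ∀ s : ℂ, 0 < s.re → ‖L s‖ ≤ ‖s‖ / s.re) {B : ℝ}
    (hB : ∀ s : ℂ, s.re = 2 → ‖F s‖ ≤ B) {δ : ℝ} (hδ : 0 < δ) {s : ℂ} (hs : 1 / 2 + δ ≤ s.re)
    (hs2 : s.re ≤ 2) : ‖F s‖ ≤ 3 / δ * (1 + B) * Real.log (8 + 2 * |s.im|) := by
  set t := s.im with ht
  set c : ℂ := 2 + t * Complex.I with hc
  have hcre : c.re = 2 := by simp [hc]
  have hcim : c.im = t := by simp [hc]
  set M := Real.log (8 + 2 * |t|) with hM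
  have hM1 : 1 ≤ M := one_le_log_eight_add t
  have hB0 : 0 ≤ B := (norm_nonneg _).trans (hB c hcre)
  have hball : ∀ z ∈ Metric.ball (0 : ℂ) (3 / 2), 1 / 2 < (c + z).re := by
    intro z hz
    have h1 := Complex.abs_re_le_norm z
    rw [mem_ball_zero_iff] at hz
    rw [Complex.add_re, hcre]
    linarith [neg_le_of_abs_le h1]
  have hz : s - c = ((s.re - 2 : ℝ) : ℂ) := by
    apply Complex.ext <;> simp [hcre, hcim, ht]
  have hznorm : ‖s - c‖ = 2 - s.re := by
    rw [hz, Complex.norm_real, Real.norm_eq_abs, abs_of_nonpos (by linarith)]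
    ring
  -- The disc of radius 3/2 about `2 + it` just fits in `Re s > 1/2`, and there `Re F = log ‖L‖ ≤
  -- M`.
  have hBC := Complex.borelCaratheodory (f := fun z => F (c + z)) (M := M) (R := 3 / 2)
    (z := s - c) (by linarith) ?_ ?_ (by norm_num) ?_
  · simp only [add_sub_cancel, add_zero] at hBC
    rw [hznorm] at hBC
    have hr : δ ≤ 3 / 2 - (2 - s.re) := by linarith
    calc ‖F s‖ ≤ 2 * M * (2 - s.re) / (3 / 2 - (2 - s.re)) +
          ‖F c‖ * (3 / 2 + (2 - s.re)) / (3 / 2 - (2 - s.re)) := hBC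
      _ ≤ 2 * M * (3 / 2) / δ + B * 3 / δ := by
          have := hB c hcre
          gcongr <;> linarith
      _ = 3 / δ * (M + B) := by ring
      _ ≤ 3 / δ * ((1 + B) * M) := by
          gcongr
          nlinarith
      _ = _ := by ring
  · exact hF.comp (by fun_prop) hball
  · intro z hzb
    have hre := hball z hzb
    have hpos : 0 < ‖L (c + z)‖ := by
      rw [← hFL _ hre]; exact norm_pos_iff.mpr (Complex.exp_ne_zero _)
    have h2 : (F (c + z)).re = Real.log ‖L (c + z)‖ := by
      rw [← hFL _ hre, Complex.norm_exp, Real.log_exp]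
    rw [Set.mem_ofPred_eq, h2]
    apply Real.log_le_log hpos
    rw [mem_ball_zero_iff] at hzb
    have hcn : ‖c‖ ≤ 2 + |t| := by
      refine (norm_add_le _ _).trans ?_
      simp
    calc ‖L (c + z)‖ ≤ ‖c + z‖ / (c + z).re := hL _ (by linarith)
      _ ≤ (2 + |t| + 3 / 2) / (1 / 2) := by
          gcongr
          exact (norm_add_le _ _).trans (by linarith)
      _ ≤ _ := by linarith [abs_nonneg t]
  · rw [mem_ball_zero_iff, hznorm]
    linarith

open Complex.HadamardThreeLines in
/-- Littlewood's convexity argument: a logarithm which is `O(log |t|)` in the strip and bounded to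
the right of the line `Re s = 1` is `o(log |t|)`. -/
lemma exists_norm_log_le {F : ℂ → ℂ} (hF : DifferentiableOn ℂ F {s | 1 / 2 < s.re})
    (hgrow : ∀ δ : ℝ, 0 < δ → ∃ C : ℝ, ∀ s : ℂ, 1 / 2 + δ ≤ s.re → s.re ≤ 2 →
      ‖F s‖ ≤ C * Real.log (8 + 2 * |s.im|))
    (hbd : ∀ δ : ℝ, 0 < δ → ∃ B : ℝ, ∀ s : ℂ, 1 + δ ≤ s.re → ‖F s‖ ≤ B)
    {δ ε : ℝ} (hδ : 0 < δ) (hε : 0 < ε) :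
    ∃ C : ℝ, ∀ s : ℂ, 1 / 2 + δ ≤ s.re → s.re ≤ 2 →
      ‖F s‖ ≤ ε * Real.log (8 + 2 * |s.im|) + C := by
  wlog hδ1 : δ ≤ 1 generalizing δ
  · obtain ⟨C, hC⟩ := this one_pos le_rfl
    exact ⟨C, fun s hs hs2 => hC s (by linarith) hs2⟩
  obtain ⟨C₁, hC₁⟩ := hgrow (δ / 2) (by linarith)
  obtain ⟨B, hB⟩ := hbd (δ / 2) (by linarith)
  have hC₁0 : 0 ≤ C₁ := by
    have := (norm_nonneg _).trans (hC₁ (3 / 2 : ℝ) (by simp; linarith) (by simp; norm_num))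
    exact nonneg_of_mul_nonneg_left this (by linarith [one_le_log_eight_add ((3 / 2 : ℝ) : ℂ).im])
  have hB0 : 0 ≤ B := (norm_nonneg _).trans (hB (2 : ℝ) (by simp; linarith))
  -- In the strip used below `0 < Re z < 2`, so `Re (z ^ 2) ≤ 4 - (Im z) ^ 2`.
  set E := Real.exp 4 with hE
  have hE1 : 0 < E := Real.exp_pos 4
  -- weight for the arithmetic-geometric mean inequality
  set μ := min 1 (ε / (2 * E * C₁ + 1)) with hμ
  have hμ0 : 0 < μ := lt_min one_pos (by positivity)
  have hμ1 : μ ≤ 1 := min_le_left _ _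
  have hμε : μ * (2 * E * C₁) ≤ ε := by
    calc μ * (2 * E * C₁) ≤ ε / (2 * E * C₁ + 1) * (2 * E * C₁ + 1) := by
          gcongr
          · exact min_le_right _ _
          · linarith
      _ = ε := div_mul_cancel₀ _ (by positivity)
  refine ⟨(E * B) * μ ^ (-(1 / δ)) + B, fun s hs hs2 => ?_⟩
  have hlog := one_le_log_eight_add s.im
  rcases le_total (1 + δ / 2) s.re with hcase | hcase
  · have h1 := hB s hcase
    have h2 : 0 ≤ E * B * μ ^ (-(1 / δ)) := by positivity
    have h3 : 0 ≤ ε * Real.log (8 + 2 * |s.im|) := by positivity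
    linarith
  set t₀ := s.im with ht₀
  set l := 1 / 2 + δ / 2 with hl
  set u := 1 + δ / 2 with hu
  have hul : u - l = 1 / 2 := by rw [hu, hl]; ring
  -- Recentring at height `t₀` and damping by `exp (z ^ 2)` makes `f` bounded in the strip, as the
  -- three lines theorem requires; on the real axis the damping factor has norm at least 1, so
  -- nothing is lost at `s`.
  let f : ℂ → ℂ := fun z => F (z + t₀ * Complex.I) * Complex.exp (z ^ 2)
  have hre : ∀ z : ℂ, (z + t₀ * Complex.I).re = z.re := fun z => by simp
  have him : ∀ z : ℂ, (z + t₀ * Complex.I).im = z.im + t₀ := fun z => by simp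
  have hexpnorm : ∀ z : ℂ, l ≤ z.re → z.re ≤ u →
      ‖Complex.exp (z ^ 2)‖ ≤ E * Real.exp (-z.im ^ 2) := by
    intro z h1 h2
    rw [Complex.norm_exp, hE, ← Real.exp_add]
    apply Real.exp_le_exp.mpr
    rw [pow_two z, Complex.mul_re]
    nlinarith
  have hbound : ∀ z : ℂ, l ≤ z.re → z.re ≤ u →
      ‖f z‖ ≤ 2 * E * C₁ * Real.log (8 + 2 * |t₀|) := by
    intro z h1 h2
    have h3 := hC₁ (z + t₀ * Complex.I) (by rw [hre]; exact h1) (by rw [hre]; linarith)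
    rw [him] at h3
    have h0 := one_le_log_eight_add t₀
    calc ‖f z‖ = ‖F (z + t₀ * Complex.I)‖ * ‖Complex.exp (z ^ 2)‖ := norm_mul _ _
      _ ≤ (C₁ * (Real.log (8 + 2 * |t₀|) * (1 + |z.im|))) * (E * Real.exp (-z.im ^ 2)) := by
          gcongr
          · exact h3.trans (by gcongr; exact log_eight_add_le _ _)
          · exact hexpnorm z h1 h2
      _ = C₁ * Real.log (8 + 2 * |t₀|) * E * ((1 + |z.im|) * Real.exp (-z.im ^ 2)) := by ring
      _ ≤ C₁ * Real.log (8 + 2 * |t₀|) * E * 2 := by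
          gcongr
          exact one_add_abs_mul_exp_neg_sq_le _
      _ = _ := by ring
  have hright : ∀ z : ℂ, z.re = u → ‖f z‖ ≤ E * B := by
    intro z h1
    have h3 := hB (z + t₀ * Complex.I) (by rw [hre, h1])
    have h4 := hexpnorm z (by rw [h1]; linarith) h1.le
    have h5 : Real.exp (-z.im ^ 2) ≤ 1 := Real.exp_le_one_iff.mpr (by nlinarith)
    calc ‖f z‖ = ‖F (z + t₀ * Complex.I)‖ * ‖Complex.exp (z ^ 2)‖ := norm_mul _ _
      _ ≤ B * (E * 1) := by
          gcongr
          exact h4.trans (by gcongr)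
      _ = _ := by ring
  have hstrip : DifferentiableOn ℂ f (verticalClosedStrip l u) := by
    refine DifferentiableOn.mul (hF.comp (by fun_prop) fun z hz => ?_) (by fun_prop)
    have : l ≤ z.re := hz.1
    rw [Set.mem_ofPred_eq, hre]
    linarith
  have hcl : closure (verticalStrip l u) ⊆ verticalClosedStrip l u :=
    closure_minimal (fun z hz => ⟨hz.1.le, hz.2.le⟩) (isClosed_Icc.preimage Complex.continuous_re)
  have h3 := norm_le_interp_of_mem_verticalClosedStrip' (f := f) (z := (s.re : ℂ))
    (a := 2 * E * C₁ * Real.log (8 + 2 * |t₀|)) (b := E * B) (l := l) (u := u) (by linarith)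
    (by constructor <;> simp <;> linarith) (hstrip.mono hcl).diffContOnCl
    ⟨2 * E * C₁ * Real.log (8 + 2 * |t₀|), by
      rintro _ ⟨z, hz, rfl⟩
      exact hbound z hz.1 hz.2⟩
    (fun z hz => hbound z (le_of_eq hz.symm) (by rw [show z.re = l from hz]; linarith))
    (fun z hz => hright z hz)
  have hfs : ‖F s‖ ≤ ‖f (s.re : ℂ)‖ := by
    have h1 : (s.re : ℂ) + t₀ * Complex.I = s := Complex.re_add_im s
    have h2 : 1 ≤ ‖Complex.exp ((s.re : ℂ) ^ 2)‖ := by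
      rw [Complex.norm_exp, ← Complex.ofReal_pow, Complex.ofReal_re]
      exact Real.one_le_exp (sq_nonneg _)
    simp only [f, norm_mul, h1]
    exact le_mul_of_one_le_right (norm_nonneg _) h2
  rw [hul, Complex.ofReal_re] at h3
  -- Interpolation gives `a^{1-κ} (E B)^κ` with `κ ≥ δ`. The positive exponent on the bounded factor
  -- lets weighted AM-GM trade it for a small multiple `μ a` plus a constant.
  set κ := (s.re - l) / (1 / 2) with hκ
  have hκδ : δ ≤ κ := by rw [hκ]; linarith
  have hκ1 : κ ≤ 1 := by rw [hκ]; linarith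
  have hκ0 : 0 < κ := by linarith
  set a := 2 * E * C₁ * Real.log (8 + 2 * |t₀|) with ha
  have ha0 : 0 ≤ a := by positivity
  have hAG := Real.geom_mean_le_arith_mean2_weighted (w₁ := 1 - κ) (w₂ := κ) (p₁ := μ * a)
    (p₂ := E * B * μ ^ (-((1 - κ) / κ))) (by linarith) hκ0.le (by positivity) (by positivity)
    (by ring)
  have heq : (μ * a) ^ (1 - κ) * (E * B * μ ^ (-((1 - κ) / κ))) ^ κ =
      a ^ (1 - κ) * (E * B) ^ κ := by
    rw [Real.mul_rpow hμ0.le ha0, Real.mul_rpow (x := E * B) (by positivity) (by positivity),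
      ← Real.rpow_mul hμ0.le, neg_mul, div_mul_cancel₀ _ hκ0.ne', Real.rpow_neg hμ0.le]
    have : μ ^ (1 - κ) ≠ 0 := (Real.rpow_pos_of_pos hμ0 _).ne'
    field_simp
  rw [heq] at hAG
  have hpow : μ ^ (-((1 - κ) / κ)) ≤ μ ^ (-(1 / δ)) := by
    apply Real.rpow_le_rpow_of_exponent_ge hμ0 hμ1
    apply neg_le_neg
    apply div_le_div₀ zero_le_one (by linarith) hδ hκδ
  calc ‖F s‖ ≤ _ := hfs
    _ ≤ _ := h3
    _ ≤ _ := hAG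
    _ ≤ 1 * (μ * a) + 1 * (E * B * μ ^ (-(1 / δ))) := by
        gcongr
        linarith
    _ ≤ _ := by
        have : μ * a ≤ ε * Real.log (8 + 2 * |t₀|) := by
          rw [ha, ← mul_assoc]
          gcongr
        linarith

end Littlewood

/-! ### Conditional bounds for `1/L(s,χ₄)` and for the continuation of `D(s;4,1)`. -/

section LiouvilleLFunctionBound

open ArithmeticFunction

/-- The coefficients of the Dirichlet series of `log L(s,χ₄)`. -/
noncomputable def chiFourLogCoeff (n : ℕ) : ℂ :=
  chiFour (n : ZMod 4) * vonMangoldt n / Real.log n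

lemma norm_chiFourLogCoeff_le (n : ℕ) : ‖chiFourLogCoeff n‖ ≤ 1 := by
  rw [chiFourLogCoeff, norm_div, norm_mul, Complex.norm_real, Complex.norm_real,
    Real.norm_of_nonneg vonMangoldt_nonneg, Real.norm_of_nonneg (Real.log_natCast_nonneg n)]
  refine div_le_one_of_le₀ ?_ (Real.log_natCast_nonneg n)
  calc _ ≤ 1 * vonMangoldt n := by
        gcongr
        · exact chiFour.norm_le_one _
    _ ≤ Real.log n := by rw [one_mul]; exact vonMangoldt_le_log

lemma LSeriesSummable_chiFourLogCoeff {s : ℂ} (hs : 1 < s.re) :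
    LSeriesSummable chiFourLogCoeff s :=
  LSeriesSummable_of_bounded_of_one_lt_re (m := 1) (fun n _ => norm_chiFourLogCoeff_le n) hs

lemma norm_LSeries_le_tsum {f : ℕ → ℂ} {x : ℝ} (hf : LSeriesSummable f x) {s : ℂ}
    (hs : x ≤ s.re) : ‖LSeries f s‖ ≤ ∑' n, ‖LSeries.term f x n‖ := by
  refine tsum_of_norm_bounded hf.norm.hasSum fun n => ?_
  exact LSeries.norm_term_le_of_re_le_re f (by simpa using hs) n

/-- With `F` a logarithm of `L`, `‖1/L‖ = exp (-Re F) ≤ exp ‖F‖`, so a bound `ε log + C` on `F`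
becomes a power with exponent `ε`. -/
lemma exists_norm_log_LFunction_chiFour_le (hRH : LFunctionRiemannHypothesis chiFour)
    {δ ε : ℝ} (hδ : 0 < δ) (hε : 0 < ε) :
    ∃ C : ℝ, ∀ s : ℂ, 1 / 2 + δ ≤ s.re → s.re ≤ 2 →
      DirichletCharacter.LFunction chiFour s ≠ 0 ∧
      ‖(DirichletCharacter.LFunction chiFour s)⁻¹‖ ≤ C * (8 + 2 * |s.im|) ^ ε := by
  have hne : ∀ s : ℂ, 1 / 2 < s.re → DirichletCharacter.LFunction chiFour s ≠ 0 := by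
    intro s hs h0
    rcases lt_or_ge s.re 1 with h1 | h1
    · exact hs.ne' (hRH s (by linarith) h1 h0)
    · exact LFunction_chiFour_ne_zero_of_one_le_re h1 h0
  obtain ⟨F, hFd, hFexp, hFH⟩ := exists_log_halfPlane (L := DirichletCharacter.LFunction chiFour)
    (H := LSeries chiFourLogCoeff) (a := 1 / 2) (b := 1) (by norm_num)
    differentiable_LFunction_chiFour.differentiableOn hne
    (by
      refine (LSeries_differentiableOn chiFourLogCoeff).continuousOn.mono fun s hs => ?_
      refine lt_of_le_of_lt (LSeries.abscissaOfAbsConv_le_of_le_const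
        ⟨1, fun n _ => norm_chiFourLogCoeff_le n⟩) ?_
      exact_mod_cast hs)
    (fun s hs => by
      rw [DirichletCharacter.LFunction_eq_LSeries chiFour hs,
        ← DirichletCharacter.LSeries_eq_exp_LSeries chiFour hs]
      rfl)
  have hbd : ∀ δ : ℝ, 0 < δ → ∃ B : ℝ, ∀ s : ℂ, 1 + δ ≤ s.re → ‖F s‖ ≤ B := by
    intro δ hδ
    refine ⟨∑' n, ‖LSeries.term chiFourLogCoeff ((1 + δ : ℝ) : ℂ) n‖, fun s hs => ?_⟩
    rw [hFH s (by linarith)]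
    exact norm_LSeries_le_tsum (LSeriesSummable_chiFourLogCoeff
      (by rw [Complex.ofReal_re]; linarith)) hs
  obtain ⟨B, hB⟩ := hbd 1 one_pos
  have hgrow : ∀ δ : ℝ, 0 < δ → ∃ C : ℝ, ∀ s : ℂ, 1 / 2 + δ ≤ s.re → s.re ≤ 2 →
      ‖F s‖ ≤ C * Real.log (8 + 2 * |s.im|) := fun δ hδ =>
    ⟨_, fun s hs hs2 => norm_log_le_of_norm_le hFd hFexp (fun s hs => norm_LFunction_chiFour_le hs)
      (fun s hs => hB s (by rw [hs]; norm_num)) hδ hs hs2⟩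
  obtain ⟨C, hC⟩ := exists_norm_log_le hFd hgrow hbd hδ hε
  refine ⟨Real.exp C, fun s hs hs2 => ⟨hne s (by linarith), ?_⟩⟩
  rw [← hFexp s (by linarith), ← Complex.exp_neg, Complex.norm_exp,
    Real.rpow_def_of_pos (by positivity), ← Real.exp_add]
  apply Real.exp_le_exp.mpr
  have h1 := hC s hs hs2
  have h2 := Complex.abs_re_le_norm (F s)
  rw [Complex.neg_re]
  linarith [neg_le_abs (F s).re]

lemma exists_norm_liouvilleLFunction_le (hRH : LFunctionRiemannHypothesis chiFour)
    {δ ε : ℝ} (hδ : 0 < δ) (hε : 0 < ε) :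
    ∃ C : ℝ, ∀ s : ℂ, 1 / 2 + δ ≤ s.re → s.re ≤ 2 →
      DifferentiableAt ℂ liouvilleLFunction s ∧
      ‖liouvilleLFunction s‖ ≤ C * (8 + 2 * |s.im|) ^ ε := by
  obtain ⟨C, hC⟩ := exists_norm_log_LFunction_chiFour_le hRH hδ hε
  have h1 : LSeriesSummable (1 : ℕ → ℂ) ((1 + 2 * δ : ℝ) : ℂ) :=
    LSeriesSummable_one_iff.mpr (by simpa using hδ)
  set Z := ∑' n, ‖LSeries.term (1 : ℕ → ℂ) ((1 + 2 * δ : ℝ) : ℂ) n‖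
  refine ⟨Z * 2 * C, fun s hs hs2 => ?_⟩
  obtain ⟨hne, hle⟩ := hC s hs hs2
  refine ⟨differentiableAt_liouvilleLFunction (by linarith) hne, ?_⟩
  have hz : ‖riemannZeta (2 * s)‖ ≤ Z := by
    rw [← LSeries_one_eq_riemannZeta (by simp; linarith)]
    exact norm_LSeries_le_tsum h1 (by simp; linarith)
  have h2 : ‖1 + (2 : ℂ) ^ (-s)‖ ≤ 2 := by
    refine (norm_add_le _ _).trans ?_
    have := Complex.norm_natCast_cpow_of_pos two_pos (-s)
    rw [Nat.cast_ofNat] at this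
    rw [this, norm_one, Complex.neg_re, Nat.cast_ofNat]
    have := Real.rpow_le_one_of_one_le_of_nonpos one_le_two (show -s.re ≤ 0 by linarith)
    linarith
  rw [liouvilleLFunction, div_eq_mul_inv, norm_mul, norm_mul]
  calc _ ≤ Z * 2 * (C * (8 + 2 * |s.im|) ^ ε) := by gcongr
    _ = _ := by ring

end LiouvilleLFunctionBound

/-! ### Perron's formula and contour shifting. -/

section Perron

open MeasureTheory Topology

lemma one_add_sq_le_norm_mul (y : ℝ) :
    1 + y ^ 2 ≤ ‖(2 + y * Complex.I : ℂ) * (2 + y * Complex.I + 1)‖ := by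
  rw [norm_mul]
  have h (c : ℝ) : ‖(c + y * Complex.I : ℂ)‖ ^ 2 = c ^ 2 + y ^ 2 := by
    rw [Complex.sq_norm, Complex.normSq_add_mul_I]
  have h2 := h 2
  have h3 := h 3
  rw [show ((3 : ℝ) : ℂ) + y * Complex.I = 2 + y * Complex.I + 1 by push_cast; ring] at h3
  rw [Complex.ofReal_ofNat] at h2
  refine le_of_sq_le_sq ?_ (by positivity)
  rw [mul_pow, h2, h3]
  nlinarith [sq_nonneg y, sq_nonneg (y ^ 2)]

lemma mul_add_one_ne_zero {s : ℂ} (hs : 0 < s.re) : s * (s + 1) ≠ 0 := by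
  refine mul_ne_zero (fun h => ?_) (fun h => ?_)
  · rw [h] at hs; simp at hs
  · have := congrArg Complex.re h
    simp at this
    linarith

lemma integrable_one_div_mul_add_one :
    Integrable fun y : ℝ => 1 / ((2 + y * Complex.I : ℂ) * (2 + y * Complex.I + 1)) := by
  refine integrable_inv_one_add_sq.mono' (Continuous.aestronglyMeasurable ?_)
    (Eventually.of_forall fun y => ?_)
  · refine continuous_const.div (by fun_prop) fun y => mul_add_one_ne_zero (by simp)
  · rw [norm_div, norm_one, one_div]
    exact inv_anti₀ (by positivity) (one_add_sq_le_norm_mul y)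

/-- The Mellin transform of `t ↦ max (1 - t) 0`. -/
lemma hasMellin_max_one_sub {s : ℂ} (hs : 0 < s.re) :
    HasMellin (fun t : ℝ => ((max (1 - t) 0 : ℝ) : ℂ)) s (1 / (s * (s + 1))) := by
  have h1 := hasMellin_one_Ioc hs
  have h2 := hasMellin_cpow_Ioc 1 (s := s) (by simp; linarith)
  have h3 := hasMellin_sub h1.1 h2.1
  rw [h1.2, h2.2] at h3
  have hval : 1 / s - 1 / (s + 1) = 1 / (s * (s + 1)) := by
    have := mul_add_one_ne_zero hs
    have h4 := left_ne_zero_of_mul this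
    have h5 := right_ne_zero_of_mul this
    field_simp
    ring
  have hfun : Set.EqOn (fun t : ℝ => (Set.Ioc 0 1).indicator (fun _ => (1 : ℂ)) t -
      (Set.Ioc 0 1).indicator (fun t : ℝ => (t : ℂ) ^ (1 : ℂ)) t)
      (fun t : ℝ => ((max (1 - t) 0 : ℝ) : ℂ)) (Set.Ioi 0) := by
    intro t ht
    simp only
    rcases le_or_gt t 1 with h | h
    · have hmem : t ∈ Set.Ioc (0 : ℝ) 1 := ⟨ht, h⟩
      rw [Set.indicator_of_mem hmem, Set.indicator_of_mem hmem, max_eq_left (by linarith)]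
      simp
    · rw [Set.indicator_of_notMem (fun hh : t ∈ Set.Ioc (0 : ℝ) 1 => absurd hh.2 h.not_ge),
        Set.indicator_of_notMem (fun hh : t ∈ Set.Ioc (0 : ℝ) 1 => absurd hh.2 h.not_ge), max_eq_right (by linarith)]
      simp
  rw [hval] at h3
  refine ⟨h3.1.congr_fun (fun t ht => ?_) measurableSet_Ioi, ?_⟩
  · exact congrArg (fun w => (t : ℂ) ^ (s - 1) • w) (hfun ht)
  · rw [← h3.2, mellin, mellin]
    refine setIntegral_congr_fun measurableSet_Ioi fun t ht => ?_
    exact congrArg (fun w => (t : ℂ) ^ (s - 1) • w) (hfun ht).symm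

/-- Mellin inversion of the tent function on `Re s = 2`. -/
lemma integral_cpow_mul_one_div {x : ℝ} (hx : 0 < x) :
    ∫ y : ℝ, (x : ℂ) ^ (-(2 + y * Complex.I)) *
      (1 / ((2 + y * Complex.I : ℂ) * (2 + y * Complex.I + 1))) =
      2 * Real.pi * (max (1 - x) 0 : ℝ) := by
  have hmel : ∀ y : ℝ, mellin (fun t : ℝ => ((max (1 - t) 0 : ℝ) : ℂ)) ((2 : ℝ) + y * Complex.I) =
      1 / ((2 + y * Complex.I : ℂ) * (2 + y * Complex.I + 1)) := fun y => by
    rw [(hasMellin_max_one_sub (by simp)).2]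
    push_cast
    rfl
  have h := mellinInv_mellin_eq 2 (fun t : ℝ => ((max (1 - t) 0 : ℝ) : ℂ)) hx
    (hasMellin_max_one_sub (by simp)).1
    (by
      unfold Complex.VerticalIntegrable
      simp_rw [hmel]
      exact integrable_one_div_mul_add_one)
    (by fun_prop)
  rw [mellinInv] at h
  simp_rw [hmel] at h
  rw [← h, Complex.real_smul]
  simp only [smul_eq_mul]
  push_cast
  rw [← mul_assoc, mul_one_div_cancel (mul_ne_zero two_ne_zero (by exact_mod_cast Real.pi_ne_zero)),
    one_mul]

lemma integral_cpow_neg_mul_cpow_add_one {X : ℝ} (hX : 0 < X) {n : ℕ} (hn : n ≠ 0) :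
    ∫ y : ℝ, (n : ℂ) ^ (-(2 + y * Complex.I)) *
      ((X : ℂ) ^ (2 + y * Complex.I + 1) / ((2 + y * Complex.I : ℂ) * (2 + y * Complex.I + 1))) =
      2 * Real.pi * (max (X - n) 0 : ℝ) := by
  have hn' : 0 < (n : ℝ) := by exact_mod_cast Nat.pos_of_ne_zero hn
  have hXc : (X : ℂ) ≠ 0 := by exact_mod_cast hX.ne'
  have h := integral_cpow_mul_one_div (x := n / X) (by positivity)
  have hmax : max (X - n) 0 = X * max (1 - n / X) 0 := by
    rw [mul_max_of_nonneg _ _ hX.le, mul_zero, mul_sub, mul_one, mul_div_cancel₀ _ hX.ne']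
  rw [hmax, Complex.ofReal_mul, mul_left_comm, ← h, ← integral_const_mul]
  refine integral_congr_ae (Eventually.of_forall fun y => ?_)
  simp only
  have h1 : ((n / X : ℝ) : ℂ) ^ (-(2 + y * Complex.I)) =
      (n : ℂ) ^ (-(2 + y * Complex.I)) * (X : ℂ) ^ (2 + y * Complex.I) := by
    rw [div_eq_mul_inv, Complex.ofReal_mul, Complex.mul_cpow_ofReal_nonneg hn'.le
      (inv_nonneg.mpr hX.le), Complex.ofReal_inv, Complex.inv_cpow _ _ (by
        rw [Complex.arg_ofReal_of_nonneg hX.le]; exact Real.pi_pos.ne), Complex.cpow_neg (X : ℂ),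
      inv_inv, Complex.ofReal_natCast]
  rw [h1, Complex.cpow_add _ _ hXc, Complex.cpow_one]
  ring

/-- The kernel of the Perron formula for sums up to the integer `N`. -/
noncomputable def perronKernel (N : ℕ) (s : ℂ) : ℂ :=
  (((N + 1 : ℕ) : ℂ) ^ (s + 1) - (N : ℂ) ^ (s + 1)) / (s * (s + 1))

lemma norm_perronKernel_le (N : ℕ) {s : ℂ} (hs : 0 < s.re) :
    ‖perronKernel N s‖ ≤ 2 * ((N : ℝ) + 1) ^ (s.re + 1) / (‖s‖ * ‖s + 1‖) := by
  rw [perronKernel, norm_div, norm_mul]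
  gcongr
  refine (norm_sub_le _ _).trans ?_
  have hne : (s + 1).re ≠ 0 := by simp; linarith
  rw [Complex.norm_natCast_cpow_of_re_ne_zero _ hne, Complex.norm_natCast_cpow_of_re_ne_zero _ hne]
  have h2 : (N : ℝ) ^ (s + 1).re ≤ ((N : ℝ) + 1) ^ (s + 1).re := by
    gcongr
    · simp; linarith
    · linarith
  push_cast
  simp only [Complex.add_re, Complex.one_re] at h2 ⊢
  linarith

/-- The mean value inequality for `u ↦ u^{s+1}` on `[N, N+1]` saves a factor `N + 1` over
`norm_perronKernel_le`, but leaves only the non-integrable decay `1/‖s‖`. -/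
lemma norm_perronKernel_le' {N : ℕ} (hN : N ≠ 0) {s : ℂ} (hs : 0 < s.re) :
    ‖perronKernel N s‖ ≤ ((N : ℝ) + 1) ^ s.re / ‖s‖ := by
  have hne := mul_add_one_ne_zero hs
  have hs0 : 0 < ‖s‖ := norm_pos_iff.mpr (left_ne_zero_of_mul hne)
  have hs1 : 0 < ‖s + 1‖ := norm_pos_iff.mpr (right_ne_zero_of_mul hne)
  have hN0 : 0 < (N : ℝ) := by exact_mod_cast Nat.pos_of_ne_zero hN
  have hder : ∀ u ∈ Set.Icc (N : ℝ) (N + 1), HasDerivWithinAt (fun u : ℝ => (u : ℂ) ^ (s + 1))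
      ((s + 1) * (u : ℂ) ^ s) (Set.Icc (N : ℝ) (N + 1)) u := by
    intro u hu
    have hu0 : 0 < u := lt_of_lt_of_le hN0 hu.1
    have h1 := ((hasDerivAt_id (u : ℂ)).cpow_const (c := s + 1)
      (Or.inl (by simpa using hu0))).comp_ofReal
    simpa using h1.hasDerivWithinAt
  have hbound : ∀ u ∈ Set.Icc (N : ℝ) (N + 1),
      ‖(s + 1) * (u : ℂ) ^ s‖ ≤ ‖s + 1‖ * ((N : ℝ) + 1) ^ s.re := by
    intro u hu
    have hu0 : 0 < u := lt_of_lt_of_le hN0 hu.1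
    rw [norm_mul, Complex.norm_cpow_eq_rpow_re_of_pos hu0]
    gcongr
    exact hu.2
  have h := (convex_Icc (N : ℝ) (N + 1)).norm_image_sub_le_of_norm_hasDerivWithin_le hder hbound
    (Set.left_mem_Icc.mpr (by linarith)) (Set.right_mem_Icc.mpr (by linarith))
  rw [add_sub_cancel_left, norm_one, mul_one] at h
  rw [perronKernel, norm_div, norm_mul, div_le_div_iff₀ (by positivity) hs0]
  push_cast at h ⊢
  calc _ ≤ ‖s + 1‖ * ((N : ℝ) + 1) ^ s.re * ‖s‖ := by gcongr
    _ = _ := by ring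

/-- The geometric mean of the two previous bounds with weights `θ` and `1 - θ` buys integrable decay
at a cost of only `(N + 1)^θ`. -/
lemma norm_perronKernel_le_rpow {N : ℕ} (hN : N ≠ 0) {s : ℂ} (hs : 1 / 2 ≤ s.re) {θ : ℝ}
    (hθ : 0 < θ) (hθ1 : θ ≤ 1) :
    ‖perronKernel N s‖ ≤ 18 * ((N : ℝ) + 1) ^ (s.re + θ) * (1 + |s.im|) ^ (-(1 + θ)) := by
  have hre : 0 < s.re := by linarith
  have hne := mul_add_one_ne_zero hre
  have hs0 : 0 < ‖s‖ := norm_pos_iff.mpr (left_ne_zero_of_mul hne)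
  have hle : ‖s‖ ≤ ‖s + 1‖ := by
    refine le_of_sq_le_sq ?_ (norm_nonneg _)
    rw [Complex.sq_norm, Complex.sq_norm, Complex.normSq_apply, Complex.normSq_apply]
    simp
    nlinarith
  have hM : 0 < (N : ℝ) + 1 := by positivity
  set M := (N : ℝ) + 1
  have h1 : ‖perronKernel N s‖ ≤ 2 * M ^ (s.re + 1) / ‖s‖ ^ 2 := by
    refine (norm_perronKernel_le N hre).trans ?_
    rw [pow_two]
    gcongr
  have h2 : ‖perronKernel N s‖ ≤ M ^ s.re / ‖s‖ := norm_perronKernel_le' hN hre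
  have h3 : 1 + |s.im| ≤ 3 * ‖s‖ := by
    have := Complex.abs_im_le_norm s
    have := Complex.abs_re_le_norm s
    rw [abs_of_pos hre] at this
    linarith
  have h4 : ‖perronKernel N s‖ ≤ 2 * (M ^ (s.re + θ) * ‖s‖ ^ (-(1 + θ))) := by
    calc ‖perronKernel N s‖ = ‖perronKernel N s‖ ^ (1 - θ) * ‖perronKernel N s‖ ^ θ := by
          rw [← Real.rpow_add_of_nonneg (norm_nonneg _) (by linarith) hθ.le, sub_add_cancel,
            Real.rpow_one]
      _ ≤ (M ^ s.re / ‖s‖) ^ (1 - θ) * (2 * M ^ (s.re + 1) / ‖s‖ ^ 2) ^ θ := by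
          gcongr
      _ = 2 ^ θ * (M ^ (s.re + θ) * ‖s‖ ^ (-(1 + θ))) := by
          rw [Real.div_rpow (by positivity) hs0.le, Real.div_rpow (by positivity) (by positivity),
            Real.mul_rpow (by positivity) (by positivity), ← Real.rpow_mul hM.le,
            ← Real.rpow_mul hM.le, ← Real.rpow_natCast, ← Real.rpow_mul hs0.le]
          rw [div_eq_mul_inv, div_eq_mul_inv, ← Real.rpow_neg hs0.le, ← Real.rpow_neg hs0.le]
          rw [show s.re + θ = s.re * (1 - θ) + (s.re + 1) * θ by ring, Real.rpow_add hM,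
            show -(1 + θ) = -(1 - θ) + -((2 : ℕ) * θ) by push_cast; ring, Real.rpow_add hs0]
          ring
      _ ≤ _ := by
          gcongr
          calc (2 : ℝ) ^ θ ≤ 2 ^ (1 : ℝ) := Real.rpow_le_rpow_of_exponent_le one_le_two hθ1
            _ = 2 := Real.rpow_one 2
  have h5 : ‖s‖ ^ (-(1 + θ)) ≤ 9 * (1 + |s.im|) ^ (-(1 + θ)) := by
    have h6 : (3 * ‖s‖) ^ (-(1 + θ)) ≤ (1 + |s.im|) ^ (-(1 + θ)) :=
      Real.rpow_le_rpow_of_nonpos (by positivity) h3 (by linarith)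
    rw [Real.mul_rpow (by norm_num) hs0.le, Real.rpow_neg (by norm_num)] at h6
    have h7 : (3 : ℝ) ^ (1 + θ) ≤ 9 := by
      calc (3 : ℝ) ^ (1 + θ) ≤ 3 ^ (2 : ℝ) :=
            Real.rpow_le_rpow_of_exponent_le (by norm_num) (by linarith)
        _ = 9 := by norm_num
    have h8 : 0 < (3 : ℝ) ^ (1 + θ) := by positivity
    rw [inv_mul_le_iff₀ h8] at h6
    exact h6.trans (by gcongr)
  calc _ ≤ _ := h4
    _ ≤ 2 * (M ^ (s.re + θ) * (9 * (1 + |s.im|) ^ (-(1 + θ)))) := by gcongr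
    _ = _ := by ring

/-- For integers, `max (N+1-n) 0 - max (N-n) 0` is exactly the indicator of `n ≤ N`; the absolutely
convergent smoothed formula thus yields a sharp cutoff. -/
lemma integrable_cpow_mul_perronKernel_and_integral {N n : ℕ} (hN : N ≠ 0) (hn : n ≠ 0) :
    Integrable (fun y : ℝ => (n : ℂ) ^ (-(2 + y * Complex.I)) *
      perronKernel N (2 + y * Complex.I)) ∧
    ∫ y : ℝ, (n : ℂ) ^ (-(2 + y * Complex.I)) * perronKernel N (2 + y * Complex.I) =
      if n ≤ N then (2 * Real.pi : ℂ) else 0 := by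
  have hint : ∀ X : ℕ, X ≠ 0 → Integrable (fun y : ℝ => (n : ℂ) ^ (-(2 + y * Complex.I)) *
      (((X : ℝ) : ℂ) ^ (2 + y * Complex.I + 1) /
        ((2 + y * Complex.I : ℂ) * (2 + y * Complex.I + 1)))) := by
    intro X hX
    have hX0 : (0 : ℝ) < X := by exact_mod_cast Nat.pos_of_ne_zero hX
    have hn0 : (0 : ℝ) < n := by exact_mod_cast Nat.pos_of_ne_zero hn
    refine (integrable_one_div_mul_add_one.norm.const_mul
      ((n : ℝ) ^ (-2 : ℝ) * (X : ℝ) ^ (3 : ℝ))).mono' (Continuous.aestronglyMeasurable ?_)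
      (Eventually.of_forall fun y => ?_)
    · have h1 : Continuous fun y : ℝ => (n : ℂ) ^ (-(2 + y * Complex.I)) :=
        Continuous.const_cpow (by fun_prop) (Or.inl (by exact_mod_cast hn))
      have h2 : Continuous fun y : ℝ => ((X : ℝ) : ℂ) ^ (2 + y * Complex.I + 1) :=
        Continuous.const_cpow (by fun_prop) (Or.inl (by exact_mod_cast hX))
      exact h1.mul (h2.div (by fun_prop) fun y => mul_add_one_ne_zero (by simp))
    · rw [norm_mul, norm_div, norm_div, norm_one, Complex.norm_cpow_eq_rpow_re_of_pos hX0,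
        Complex.norm_natCast_cpow_of_pos (Nat.pos_of_ne_zero hn)]
      simp only [Complex.neg_re, Complex.add_re, Complex.re_ofNat, Complex.mul_I_re,
        Complex.ofReal_im, neg_zero, add_zero, Complex.one_re]
      norm_num
      exact le_of_eq (by ring)
  have hN1 := hint (N + 1) (by omega)
  have hN2 := hint N hN
  have hfun : (fun y : ℝ => (n : ℂ) ^ (-(2 + y * Complex.I)) *
      perronKernel N (2 + y * Complex.I)) = fun y : ℝ =>
      (n : ℂ) ^ (-(2 + y * Complex.I)) * ((((N + 1 : ℕ) : ℝ) : ℂ) ^ (2 + y * Complex.I + 1) /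
        ((2 + y * Complex.I : ℂ) * (2 + y * Complex.I + 1))) -
      (n : ℂ) ^ (-(2 + y * Complex.I)) * (((N : ℝ) : ℂ) ^ (2 + y * Complex.I + 1) /
        ((2 + y * Complex.I : ℂ) * (2 + y * Complex.I + 1))) := by
    funext y
    rw [perronKernel, sub_div, mul_sub, Complex.ofReal_natCast, Complex.ofReal_natCast]
  rw [hfun]
  refine ⟨hN1.sub hN2, ?_⟩
  rw [integral_sub hN1 hN2, integral_cpow_neg_mul_cpow_add_one (by positivity) hn,
    integral_cpow_neg_mul_cpow_add_one (by exact_mod_cast Nat.pos_of_ne_zero hN) hn]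
  split_ifs with h
  · have h1 : (n : ℝ) ≤ N := by exact_mod_cast h
    rw [max_eq_left (by push_cast; linarith), max_eq_left (by linarith)]
    push_cast
    ring
  · have h1 : (N : ℝ) + 1 ≤ n := by exact_mod_cast not_le.mp h
    rw [max_eq_right (by push_cast; linarith), max_eq_right (by linarith)]
    simp

/-- Perron's formula on the line `Re s = 2`. -/
theorem integral_LSeries_mul_perronKernel {a : ℕ → ℂ} (ha : LSeriesSummable a 2) {N : ℕ}
    (hN : N ≠ 0) :
    ∫ y : ℝ, LSeries a (2 + y * Complex.I) * perronKernel N (2 + y * Complex.I) =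
      2 * Real.pi * ∑ n ∈ Finset.Icc 1 N, a n := by
  have hterm : ∀ n : ℕ, n ≠ 0 → ∀ s : ℂ, LSeries.term a s n = a n * (n : ℂ) ^ (-s) := by
    intro n hn s
    rw [LSeries.term_of_ne_zero hn, Complex.cpow_neg, div_eq_mul_inv]
  have hint : ∀ n : ℕ, Integrable fun y : ℝ => LSeries.term a (2 + y * Complex.I) n *
      perronKernel N (2 + y * Complex.I) := by
    intro n
    rcases eq_or_ne n 0 with rfl | hn
    · simp
    · simp_rw [hterm n hn, mul_assoc]
      exact (integrable_cpow_mul_perronKernel_and_integral hN hn).1.const_mul _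
  have hval : ∀ n : ℕ, ∫ y : ℝ, LSeries.term a (2 + y * Complex.I) n *
      perronKernel N (2 + y * Complex.I) =
      if n ∈ Finset.Icc 1 N then 2 * Real.pi * a n else 0 := by
    intro n
    rcases eq_or_ne n 0 with rfl | hn
    · simp
    · simp_rw [hterm n hn, mul_assoc]
      rw [integral_const_mul, (integrable_cpow_mul_perronKernel_and_integral hN hn).2]
      have : n ∈ Finset.Icc 1 N ↔ n ≤ N := by simp; omega
      simp only [this]
      split_ifs <;> ring
  -- The norm of a term is constant along the vertical line, so absolute convergence at 2 justifies
  -- exchanging sum and integral.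
  have hnorm : ∀ n : ℕ, ∀ y : ℝ, ‖LSeries.term a (2 + y * Complex.I) n *
      perronKernel N (2 + y * Complex.I)‖ =
        ‖LSeries.term a 2 n‖ * ‖perronKernel N (2 + y * Complex.I)‖ := by
    intro n y
    rw [norm_mul]
    congr 1
    refine le_antisymm (LSeries.norm_term_le_of_re_le_re a (by simp) n)
      (LSeries.norm_term_le_of_re_le_re a (by simp) n)
  have hsum : Summable fun n : ℕ => ∫ y : ℝ, ‖LSeries.term a (2 + y * Complex.I) n *
      perronKernel N (2 + y * Complex.I)‖ := by
    simp_rw [hnorm, integral_const_mul]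
    exact ha.norm.mul_right _
  have h := hasSum_integral_of_summable_integral_norm hint hsum
  simp_rw [hval] at h
  have h2 : HasSum (fun n => if n ∈ Finset.Icc 1 N then 2 * Real.pi * a n else 0)
      (∑ n ∈ Finset.Icc 1 N, 2 * Real.pi * a n) := by
    rw [← Finset.sum_congr rfl fun n hn => if_pos hn]
    exact hasSum_sum_of_ne_finset_zero fun n hn => if_neg hn
  rw [Finset.mul_sum, h2.unique h]
  refine integral_congr_ae (Eventually.of_forall fun y => ?_)
  simp only
  rw [tsum_mul_right]
  rfl

/-- Shifting the line of integration. -/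
theorem integral_vertical_line_eq {f : ℂ → ℂ} {a b : ℝ} (hab : a ≤ b)
    (hf : ∀ s : ℂ, a ≤ s.re → s.re ≤ b → DifferentiableAt ℂ f s) {C r : ℝ} (hr : 1 < r)
    (hbd : ∀ s : ℂ, a ≤ s.re → s.re ≤ b → ‖f s‖ ≤ C * (1 + |s.im|) ^ (-r)) :
    ∫ y : ℝ, f (a + y * Complex.I) = ∫ y : ℝ, f (b + y * Complex.I) := by
  have hint : ∀ c : ℝ, a ≤ c → c ≤ b → Integrable fun y : ℝ => f (c + y * Complex.I) := by
    intro c h1 h2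
    have hg : Integrable fun y : ℝ => (1 + ‖y‖) ^ (-r) :=
      integrable_one_add_norm (by simpa using hr)
    refine (hg.const_mul C).mono' (Continuous.aestronglyMeasurable ?_)
      (Eventually.of_forall fun y => ?_)
    · refine continuous_iff_continuousAt.mpr fun y => ?_
      exact ContinuousAt.comp (g := f) (hf _ (by simpa) (by simpa)).continuousAt (by fun_prop)
    · simpa using hbd (c + y * Complex.I) (by simpa) (by simpa)
  have hC : 0 ≤ C := by
    have := (norm_nonneg _).trans (hbd (a : ℝ) (by simp) (by simpa))
    exact nonneg_of_mul_nonneg_left this (by positivity)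
  have hrect : ∀ T : ℝ, 0 ≤ T → (∫ x : ℝ in a..b, f (x + (-T : ℝ) * Complex.I)) -
      (∫ x : ℝ in a..b, f (x + T * Complex.I)) +
      Complex.I • (∫ y : ℝ in (-T)..T, f (b + y * Complex.I)) -
      Complex.I • (∫ y : ℝ in (-T)..T, f (a + y * Complex.I)) = 0 := by
    intro T hT
    have h := Complex.integral_boundary_rect_eq_zero_of_differentiableOn f
      (a + (-T : ℝ) * Complex.I) (b + T * Complex.I) (fun z hz => by
        have h1 := hz.1
        simp only [Set.mem_preimage, Complex.add_re, Complex.ofReal_re, Complex.mul_I_re,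
          Complex.ofReal_im, neg_zero, add_zero, Set.uIcc_of_le hab] at h1
        exact (hf z h1.1 h1.2).differentiableWithinAt)
    simpa using h
  have hdecay : Tendsto (fun T : ℝ => C * (1 + T) ^ (-r) * |b - a|) atTop (𝓝 0) := by
    have h1 : Tendsto (fun T : ℝ => (1 + T) ^ (-r)) atTop (𝓝 0) :=
      (tendsto_rpow_neg_atTop (by linarith)).comp (tendsto_atTop_add_const_left _ _ tendsto_id)
    simpa using (h1.const_mul C).mul_const |b - a|
  -- Here `ε = ±1` handles the top and bottom edges together.
  have hhor : ∀ ε : ℝ, |ε| = 1 → Tendsto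
      (fun T : ℝ => ∫ x : ℝ in a..b, f (x + (ε * T : ℝ) * Complex.I)) atTop (𝓝 0) := by
    intro ε hε
    refine squeeze_zero_norm' ?_ hdecay
    filter_upwards [eventually_ge_atTop 0] with T hT
    refine intervalIntegral.norm_integral_le_of_norm_le_const fun x hx => ?_
    rw [Set.uIoc_of_le hab] at hx
    have := hbd (x + (ε * T : ℝ) * Complex.I) (by simpa using hx.1.le) (by simpa using hx.2)
    have him : (x + (ε * T : ℝ) * Complex.I : ℂ).im = ε * T := by simp
    rwa [him, abs_mul, hε, one_mul, abs_of_nonneg hT] at this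
  have hver : ∀ c : ℝ, a ≤ c → c ≤ b → Tendsto
      (fun T : ℝ => ∫ y : ℝ in (-T)..T, f (c + y * Complex.I)) atTop
      (𝓝 (∫ y : ℝ, f (c + y * Complex.I))) := fun c h1 h2 =>
    intervalIntegral_tendsto_integral (hint c h1 h2) tendsto_neg_atTop_atBot tendsto_id
  have hlim := (((hhor (-1) (by simp)).sub (hhor 1 (by simp))).add
    ((hver b hab le_rfl).const_smul Complex.I)).sub ((hver a le_rfl hab).const_smul Complex.I)
  have hzero := tendsto_nhds_unique hlim (tendsto_const_nhds.congr' (by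
    filter_upwards [eventually_ge_atTop 0] with T hT
    rw [neg_one_mul, one_mul, hrect T hT]))
  rw [sub_zero, zero_add, ← smul_sub, smul_eq_zero] at hzero
  exact (sub_eq_zero.mp (hzero.resolve_left Complex.I_ne_zero)).symm

end Perron

/-! ### The conditional bound for `λ(n;4,1)`. -/

section Conditional

open MeasureTheory

lemma differentiableAt_perronKernel {N : ℕ} (hN : N ≠ 0) {s : ℂ} (hs : 0 < s.re) :
    DifferentiableAt ℂ (perronKernel N) s := by
  have h1 : ∀ n : ℕ, n ≠ 0 → DifferentiableAt ℂ (fun s : ℂ => (n : ℂ) ^ (s + 1)) s := fun n hn =>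
    DifferentiableAt.const_cpow (by fun_prop) (Or.inl (by exact_mod_cast hn))
  exact ((h1 (N + 1) (by omega)).sub (h1 N hN)).div (by fun_prop) (mul_add_one_ne_zero hs)

lemma exists_norm_liouvilleLFunction_mul_perronKernel_le
    (hRH : LFunctionRiemannHypothesis chiFour) {δ θ : ℝ} (hδ : 0 < δ) (hθ : 0 < θ) (hθ1 : θ ≤ 1) :
    ∃ C : ℝ, ∀ N : ℕ, N ≠ 0 → ∀ s : ℂ, 1 / 2 + δ ≤ s.re → s.re ≤ 2 →
      ‖liouvilleLFunction s * perronKernel N s‖ ≤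
        C * ((N : ℝ) + 1) ^ (s.re + θ) * (1 + |s.im|) ^ (-(1 + θ / 2)) := by
  -- Half of the kernel's surplus decay `θ` pays for the growth of the continued series; the
  -- remaining `θ / 2` keeps the integral convergent.
  obtain ⟨C, hC⟩ := exists_norm_liouvilleLFunction_le hRH hδ (half_pos hθ)
  refine ⟨C * 8 ^ (θ / 2) * 18, fun N hN s hs hs2 => ?_⟩
  have h1 := (hC s hs hs2).2
  have hpos : 0 < 1 + |s.im| := by positivity
  have hC0 : 0 ≤ C := by
    have := (norm_nonneg _).trans h1
    exact nonneg_of_mul_nonneg_left this (by positivity)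
  have h2 := norm_perronKernel_le_rpow hN (s := s) (by linarith) hθ hθ1
  have h3 : (8 + 2 * |s.im|) ^ (θ / 2) ≤ 8 ^ (θ / 2) * (1 + |s.im|) ^ (θ / 2) := by
    rw [← Real.mul_rpow (by norm_num) hpos.le]
    gcongr
    linarith [abs_nonneg s.im]
  rw [norm_mul]
  calc _ ≤ (C * (8 ^ (θ / 2) * (1 + |s.im|) ^ (θ / 2))) *
        (18 * ((N : ℝ) + 1) ^ (s.re + θ) * (1 + |s.im|) ^ (-(1 + θ))) := by
        gcongr
        exact h1.trans (by gcongr)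
    _ = _ := by
        rw [show -(1 + θ / 2) = θ / 2 + -(1 + θ) by ring, Real.rpow_add hpos]
        ring

lemma exists_abs_sum_liouvilleAP_four_one_le (hRH : LFunctionRiemannHypothesis chiFour)
    {ε : ℝ} (hε : 0 < ε) (hε1 : ε ≤ 1) :
    ∃ C : ℝ, ∀ N : ℕ, N ≠ 0 →
      |∑ n ∈ Finset.Icc 1 N, (liouvilleAP 4 1 n : ℝ)| ≤ C * ((N : ℝ) + 1) ^ (1 / 2 + ε) := by
  -- The loss `ε` is shared equally between the line `Re s = 1/2 + ε/2` and the kernel exponent `θ =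
  -- ε/2`.
  obtain ⟨C, hC⟩ := exists_norm_liouvilleLFunction_mul_perronKernel_le hRH (half_pos hε)
    (half_pos hε) (by linarith)
  obtain ⟨_, hdiff⟩ := exists_norm_liouvilleLFunction_le hRH (half_pos hε) one_pos
  set r := 1 + ε / 2 / 2 with hr
  have hr1 : 1 < r := by rw [hr]; linarith
  set J := ∫ y : ℝ, (1 + |y|) ^ (-r) with hJ
  have hint : Integrable fun y : ℝ => (1 + |y|) ^ (-r) :=
    integrable_one_add_norm (by simpa using hr1)
  refine ⟨C * J, fun N hN => ?_⟩
  have hN1 : 1 ≤ (N : ℝ) + 1 := by linarith [N.cast_nonneg (α := ℝ)]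
  have hC0 : 0 ≤ C := by
    have := (norm_nonneg _).trans (hC N hN (2 : ℝ) (by simp; linarith) (by simp))
    rw [mul_assoc] at this
    exact nonneg_of_mul_nonneg_left this (by positivity)
  have hP := integral_LSeries_mul_perronKernel (a := fun n => (liouvilleAP 4 1 n : ℂ))
    (LSeriesSummable_liouvilleAP 4 1 (by simp)) hN
  have hP' : ∫ y : ℝ, liouvilleLFunction ((2 : ℝ) + y * Complex.I) *
      perronKernel N ((2 : ℝ) + y * Complex.I) =
      2 * Real.pi * ∑ n ∈ Finset.Icc 1 N, (liouvilleAP 4 1 n : ℂ) := by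
    rw [← hP]
    refine integral_congr_ae (Eventually.of_forall fun y => ?_)
    simp only
    rw [LSeries_liouvilleAP_eq (by simp), liouvilleLFunction, Complex.ofReal_ofNat]
  -- The shift needs decay only for fixed `N`, so the crude exponent `2 + ε/2`, worst at the right
  -- edge, is harmless.
  rw [← integral_vertical_line_eq (f := fun s => liouvilleLFunction s * perronKernel N s)
    (a := 1 / 2 + ε / 2) (b := 2) (C := C * ((N : ℝ) + 1) ^ (2 + ε / 2)) (r := r) (by linarith)
    (fun s h1 h2 => (hdiff s h1 h2).1.mul (differentiableAt_perronKernel hN (by linarith))) hr1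
    (fun s h1 h2 => (hC N hN s h1 h2).trans (by gcongr))] at hP'
  have hnorm := norm_integral_le_of_norm_le (hint.const_mul (C * ((N : ℝ) + 1) ^ (1 / 2 + ε)))
    (Eventually.of_forall fun y : ℝ => show ‖liouvilleLFunction ((1 / 2 + ε / 2 : ℝ) +
      y * Complex.I) * perronKernel N ((1 / 2 + ε / 2 : ℝ) + y * Complex.I)‖ ≤
        C * ((N : ℝ) + 1) ^ (1 / 2 + ε) * (1 + |y|) ^ (-r) from by
      set s : ℂ := (1 / 2 + ε / 2 : ℝ) + y * Complex.I with hs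
      have hre : s.re = 1 / 2 + ε / 2 := by
        rw [hs, Complex.add_re, Complex.ofReal_re, Complex.mul_I_re, Complex.ofReal_im]
        ring
      have him : s.im = y := by
        rw [hs, Complex.add_im, Complex.ofReal_im, Complex.mul_I_im, Complex.ofReal_re, zero_add]
      have h := hC N hN s hre.ge (by rw [hre]; linarith)
      rw [hre, him] at h
      convert h using 3
      ring_nf)
  rw [hP', integral_const_mul, ← hJ] at hnorm
  have hpi : ‖(2 * Real.pi : ℂ)‖ = 2 * Real.pi := by
    rw [← Complex.ofReal_ofNat, ← Complex.ofReal_mul, Complex.norm_real,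
      Real.norm_of_nonneg (by positivity)]
  have hcast : ∑ n ∈ Finset.Icc 1 N, (liouvilleAP 4 1 n : ℂ) =
      ((∑ n ∈ Finset.Icc 1 N, (liouvilleAP 4 1 n : ℝ) : ℝ) : ℂ) := by push_cast; rfl
  rw [norm_mul, hpi, hcast, Complex.norm_real, Real.norm_eq_abs] at hnorm
  calc |∑ n ∈ Finset.Icc 1 N, (liouvilleAP 4 1 n : ℝ)| ≤
        2 * Real.pi * |∑ n ∈ Finset.Icc 1 N, (liouvilleAP 4 1 n : ℝ)| :=
        le_mul_of_one_le_left (abs_nonneg _) (by linarith [Real.pi_gt_three])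
    _ ≤ _ := hnorm
    _ = _ := by ring

lemma liouvilleAPSum_four_one_isBigO (hRH : LFunctionRiemannHypothesis chiFour) {ε : ℝ}
    (hε : 0 < ε) :
    (fun x : ℝ => liouvilleAPSum 4 1 x) =O[atTop] (fun x : ℝ => x ^ (1 / 2 + ε)) := by
  wlog hε1 : ε ≤ 1 generalizing ε
  · refine (this one_pos le_rfl).trans (IsBigO.of_bound 1 ?_)
    filter_upwards [eventually_ge_atTop 1] with x hx
    rw [one_mul, Real.norm_of_nonneg (by positivity), Real.norm_of_nonneg (by positivity)]
    exact Real.rpow_le_rpow_of_exponent_le hx (by linarith)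
  obtain ⟨C, hC⟩ := exists_abs_sum_liouvilleAP_four_one_le hRH hε hε1
  have hC0 : 0 ≤ C := by
    have := (abs_nonneg _).trans (hC 1 one_ne_zero)
    exact nonneg_of_mul_nonneg_left this (by positivity)
  refine IsBigO.of_bound (C * 2 ^ (1 / 2 + ε)) ?_
  filter_upwards [eventually_ge_atTop 1] with x hx
  rw [Real.norm_eq_abs, Real.norm_of_nonneg (by positivity), mul_assoc,
    ← Real.mul_rpow zero_le_two (by linarith)]
  refine (hC ⌊x⌋₊ (Nat.floor_pos.mpr hx).ne').trans ?_
  gcongr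
  linarith [Nat.floor_le (show 0 ≤ x by linarith)]

end Conditional

theorem mainTheorem5 :
    -- the Dirichlet series of `λ(n;4,1)` in its half-plane of absolute convergence
    (∀ s : ℂ, 1 < s.re →
      DirichletCharacter.LFunction chiFour s ≠ 0 ∧
      LSeriesHasSum (fun n => (liouvilleAP 4 1 n : ℂ)) s
        (riemannZeta (2 * s) * (1 + (2 : ℂ) ^ (-s)) /
          DirichletCharacter.LFunction chiFour s)) ∧
    -- unconditional bound for `λ(n;4,1)`
    (fun x : ℝ => liouvilleAPSum 4 1 x) =o[atTop] (fun x : ℝ => x) ∧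
    -- conditional bound for `λ(n;4,1)`
    (LFunctionRiemannHypothesis chiFour →
      ∀ ε : ℝ, 0 < ε →
        (fun x : ℝ => liouvilleAPSum 4 1 x) =O[atTop] (fun x : ℝ => x ^ (1 / 2 + ε))) ∧
    -- nonnegativity and growth for `λ(n;4,3)`
    (∀ x : ℝ, 1 ≤ x → 0 ≤ liouvilleAPSum 4 3 x) ∧
    (∀ ε : ℝ, 0 < ε →
      (fun x : ℝ => liouvilleAPSum 4 3 x) =o[atTop] (fun x : ℝ => x ^ ε)) := by

  exact ⟨fun s hs => ⟨LFunction_chiFour_ne_zero_of_one_le_re hs.le, LSeriesHasSum_liouvilleAP hs⟩,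
    liouvilleAPSum_four_one_isLittleO, fun hRH _ hε => liouvilleAPSum_four_one_isBigO hRH hε,
    fun x _ => liouvilleAPSum_four_three_nonneg x,
    fun _ hε => liouvilleAPSum_four_three_isLittleO hε⟩
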